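/- A $(p,q)$-leaper moves from a square $a$ to any of the squares $a+(\pm p,\pm q)$, $a+(\pm q,\pm p)$. For $m<n$, an $(m,n)$-frame is an $(m+n)\times(m+n)$ chessboard with its central $(n-m)\times(n-m)$ squares removed; extending the sides of the hole dissects it into eight sections $F_i$, where $i$ is one of the eight directions, numbered $0,\dots,7$ counterclockwise from east and taken modulo $8$. The lifting transformations $f,g,h$ take an $(m,n)$-frame $F$ to the concentric $(m,2m+n)$-, $(n,2n-m)$-, $(n,m+2n)$-frame $H$, respectively. They map a set $S$ of squares of $F$ to $\bigcup_i (S+v_i)\cap H_i$, where $v_i$ is the vector in direction $i$ that is a move of a $(0,m+n)$-, $(0,n-m)$-, $(0,m+n)$-leaper for $i=0,2,4,6$ and of an $(m,m)$-, $(n,n)$-, $(n,n)$-leaper for $i=1,3,5,7$, for $f$, $g$, $h$ respectively. Let $L$ be a $(p,q)$-leaper with $0<p<q$, $\gcd(p,q)=1$ and $p+q$ odd. The descent of $L$ is the string $e_1\dots e_l$ over $\{f,g,h\}$ such that applying liftings of types $e_l,\dots,e_1$, in this order, to a $(1,2)$-frame yields a $(p,q)$-frame. Types of cycles of $L$ within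 a $(p+q)\times(p+q)$ chessboard are defined recursively along the descent. The only cycle of a $(1,2)$-leaper, whose squares form the $(1,2)$-frame, is of type $1$. Lifting by $f$ takes each cycle of type $i$ to one of type $i$; lifting by $g$ or $h$ takes each cycle of type $i$ to one of type $i+1$, and the new cycles, which lie in the shell of the larger frame, are of type $1$. (The shell of an $(m,n)$-frame, $m<n\le 3m$, consists of eight square subboards, one in each section. If $n\le 2m$, they have side $n-m$ and are the four corners and the four subboards adjacent by side to the hole; if $n>2m$, they have side $3m-n$ and are in the middles of the four outer sides and adjacent by corner to the hole.) A cycle within a $(p,q)$-frame $F$ is proper if it is a concatenation $a^0a^1\cdots a^7$ of eight disjoint nonempty paths with $a^i$ in $F_i$ such that, for all $i$, the $L$-translation taking $F_i\cup F_{i+1}$ onto $F_{i+5}\cup F_{i+4}$ takes $a^ia^{i+1}$ onto the reverse of $a^{i+5}$ followed by the reverse of $a^{i+4}$. Let $$\frac qp=[c_1\pm,c_2\pm,\dots,c_k]=c_1\pm\cfrac{1}{c_2\pm\cfrac{1}{\ddots\pm\frac1{c_k}}}$$ be the representation of $q/p$ with all $c_i$ even, $c_1\ge 0$ and $c_2,\dots,c_k>0$,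 and let $l_k$ be the numerator in lowest terms of $[c_1\pm,2-,c_2\pm,2-,\dots,c_k]$. **Theorem (third leaper).** We have $c_k=2$ if and only if the descent of $L$ is empty or ends in $g$ or $h$. Suppose that $c_k=2$ and that $l_k$ is not divisible by $3$. Then there is a unique cycle $C$ of $L$ of type $k$ within a $(p+q)\times(p+q)$ chessboard, and there is a Hamiltonian cycle of a $(1,2)$-leaper (knight) over the squares of $C$. More precisely, a proper Hamiltonian cycle of a $(0,1)$-leaper over the squares of $C$ exists, and for every such cycle $a_0,a_1,\dots,a_{N-1}$ (indices modulo $N$) the sequence $a_0,a_3,a_6,\dots,a_{3(N-1)}$ is a Hamiltonian cycle of a $(1,2)$-leaper over the squares of $C$. -/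

import Mathlib

namespace Leaper

/-! Squares of the infinite chessboard are represented by their centers. All boards below are centered
at the origin and have odd side, so that the centers of their squares are integer points. -/

/-- A square of the infinite chessboard. -/
abbrev Square := ℤ × ℤ

/-- `v` is a move of the `(p, q)`-leaper: one of `(±p, ±q)`, `(±q, ±p)`. -/
def IsMove (p q : ℕ) (v : Square) : Prop :=
  (v.1.natAbs = p ∧ v.2.natAbs = q) ∨ (v.1.natAbs = q ∧ v.2.natAbs = p)

/-- The leaper graph of the `(p, q)`-leaper over the infinite chessboard. -/
def leaperGraph (p q : ℕ) : SimpleGraph Square where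
  Adj a b := a ≠ b ∧ IsMove p q (b - a)
  symm := ⟨fun a b h => by
    refine ⟨h.1.symm, ?_⟩
    have h2 := h.2
    simp only [IsMove, Prod.fst_sub, Prod.snd_sub] at h2 ⊢
    omega⟩
  loopless := ⟨fun _ h => h.1 rfl⟩

/-- The leaper graph of the `(p, q)`-leaper over a board `S`. -/
abbrev leaperGraphOn (p q : ℕ) (S : Set Square) : SimpleGraph S := (leaperGraph p q).induce S

/-- There is a Hamiltonian cycle of the `(p, q)`-leaper over the squares of `S`. -/
def IsToured (p q : ℕ) (S : Set Square) : Prop :=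
  ∃ (a : S) (w : (leaperGraphOn p q S).Walk a a), w.IsHamiltonianCycle

/-- The `(p + q) × (p + q)` chessboard centered at the origin (for `p + q` odd). -/
def board (p q : ℕ) : Set Square :=
  {s | |2 * s.1| < (p + q : ℤ) ∧ |2 * s.2| < (p + q : ℤ)}

/-- `S` is the vertex set of a cycle of the `(p, q)`-leaper within the `(p + q) × (p + q)` board. -/
def IsCycleSet (p q : ℕ) (S : Set Square) : Prop :=
  S ⊆ board p q ∧ IsToured p q S

/-! ### Frames and sections -/

/-- The eight directions E, NE, N, NW, W, SW, S, SE, numbered counterclockwise from `0`. Addition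
of `Fin 8` is cyclic, so `i + k` is `k` steps counterclockwise from `i`, and `i + 4` is opposite `i`. -/
abbrev Dir := Fin 8

/-- The horizontal and vertical signs of a direction. -/
def dirVec : Dir → Square :=
  ![(1, 0), (1, 1), (0, 1), (-1, 1), (-1, 0), (-1, -1), (0, -1), (1, -1)]

/-- The range of a coordinate of the squares of a section of the `(m, n)`-frame,
`d` being the sign of the direction of the section along that coordinate. -/
def strip (m n : ℕ) (d x : ℤ) : Prop :=
  if d = 0 then |2 * x| < (n - m : ℤ)
  else (n - m : ℤ) < 2 * (d * x) ∧ 2 * (d * x) < (m + n : ℤ)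

/-- The section in direction `i` of the `(m, n)`-frame, `m < n`, `m + n` odd, centered at the origin. -/
def frameSection (m n : ℕ) (i : Dir) : Set Square :=
  {s | strip m n (dirVec i).1 s.1 ∧ strip m n (dirVec i).2 s.2}

/-- The `(m, n)`-frame: the `(m + n) × (m + n)` board without its central `(n - m) × (n - m)` hole. -/
def frame (m n : ℕ) : Set Square :=
  board m n \ {s | |2 * s.1| < (n - m : ℤ) ∧ |2 * s.2| < (n - m : ℤ)}

/-- The shell of an `(m, n)`-frame, `m < n ≤ 3 m`: eight square subboards, one in each section.
If `n ≤ 2 m`, they have side `n - m` and are the four corners and the four subboards adjacent by side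
to the hole; if `2 m < n`, they have side `3 m - n` and are in the middles of the four outer sides and
adjacent by corner to the hole. -/
def shell (m n : ℕ) : Set Square :=
  {s | ∃ i : Dir, s ∈ frameSection m n i ∧
    if (dirVec i).1 ≠ 0 ∧ (dirVec i).2 ≠ 0 then
      -- a corner section
      if n ≤ 2 * m then
        (3 * m - n : ℤ) < 2 * |s.1| ∧ (3 * m - n : ℤ) < 2 * |s.2|
      else
        2 * |s.1| < (5 * m - n : ℤ) ∧ 2 * |s.2| < (5 * m - n : ℤ)
    else
      -- a side section
      if n ≤ 2 * m then
        2 * max |s.1| |s.2| < (3 * (n - m) : ℤ)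
      else
        (3 * n - 5 * m : ℤ) < 2 * max |s.1| |s.2| ∧ 2 * min |s.1| |s.2| < (3 * m - n : ℤ)}

/-! ### Lifting transformations, descents, and types of cycles -/

/-- The three lifting transformations. -/
inductive Lifting
  | f
  | g
  | h

/-- The proportions of the frame to which an `(m, n)`-frame is lifted. -/
def Lifting.target : Lifting → ℕ × ℕ → ℕ × ℕ
  | .f, (m, n) => (m, 2 * m + n)
  | .g, (m, n) => (n, 2 * n - m)
  | .h, (m, n) => (n, m + 2 * n)

/-- The translation in direction `i` of the given lifting of an `(m, n)`-frame: a move of a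
`(0, m + n)`-, `(0, n - m)`-, `(0, m + n)`-leaper towards E, N, W, S, and of an
`(m, m)`-, `(n, n)`-, `(n, n)`-leaper towards NE, NW, SW, SE, for `f`, `g`, `h`, respectively. -/
def Lifting.shift (t : Lifting) (m n : ℕ) (i : Dir) : Square :=
  let side : ℤ := match t with
    | .f => m + n
    | .g => n - m
    | .h => m + n
  let corner : ℤ := match t with
    | .f => m
    | .g => n
    | .h => n
  (if (dirVec i).1 ≠ 0 ∧ (dirVec i).2 ≠ 0 then corner else side) • dirVec i

/-- The image of a set `S` of squares of the `(m, n)`-frame under a lifting transformation. -/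
def Lifting.lift (t : Lifting) (m n : ℕ) (S : Set Square) : Set Square :=
  {b | ∃ i : Dir, b ∈ frameSection (t.target (m, n)).1 (t.target (m, n)).2 i ∧
    b - t.shift m n i ∈ S}

/-- The frame to which liftings of types `e_l`, …, `e_2`, `e_1`, in this order,
lift the `(1, 2)`-frame. -/
def frameOfWord : List Lifting → ℕ × ℕ
  | [] => (1, 2)
  | t :: e => t.target (frameOfWord e)

/-- The word `e` is the descent of the `(p, q)`-leaper. -/
def IsDescent (p q : ℕ) (e : List Lifting) : Prop := frameOfWord e = (p, q)

/-- `CycleOfWord e i S`: `S` is the vertex set of a cycle of type `i` of the leaper of descent `e`.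
The only cycle of the `(1, 2)`-leaper is of type `1`. Lifting by `f` extends each cycle and preserves
its type. Lifting by `g` or `h` extends each cycle of type `i` to one of type `i + 1`, and
the new cycles, within the shell, are of type `1`. -/
inductive CycleOfWord : List Lifting → ℕ → Set Square → Prop
  | base : CycleOfWord [] 1 (frame 1 2)
  | lift_f {e : List Lifting} {i : ℕ} {S : Set Square} : CycleOfWord e i S →
      CycleOfWord (.f :: e) i (Lifting.f.lift (frameOfWord e).1 (frameOfWord e).2 S)
  | lift_g {e : List Lifting} {i : ℕ} {S : Set Square} : CycleOfWord e i S →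
      CycleOfWord (.g :: e) (i + 1) (Lifting.g.lift (frameOfWord e).1 (frameOfWord e).2 S)
  | lift_h {e : List Lifting} {i : ℕ} {S : Set Square} : CycleOfWord e i S →
      CycleOfWord (.h :: e) (i + 1) (Lifting.h.lift (frameOfWord e).1 (frameOfWord e).2 S)
  | shell_g {e : List Lifting} {S : Set Square} :
      IsCycleSet (frameOfWord (.g :: e)).1 (frameOfWord (.g :: e)).2 S →
      S ⊆ shell (frameOfWord (.g :: e)).1 (frameOfWord (.g :: e)).2 →
      CycleOfWord (.g :: e) 1 S
  | shell_h {e : List Lifting} {S : Set Square} :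
      IsCycleSet (frameOfWord (.h :: e)).1 (frameOfWord (.h :: e)).2 S →
      S ⊆ shell (frameOfWord (.h :: e)).1 (frameOfWord (.h :: e)).2 →
      CycleOfWord (.h :: e) 1 S

/-- `S` is the vertex set of a cycle of type `i` of the skew basic `(p, q)`-leaper, `p < q`. -/
def IsCycleOfType (p q i : ℕ) (S : Set Square) : Prop :=
  ∃ e : List Lifting, IsDescent p q e ∧ CycleOfWord e i S

/-! ### Proper cycles -/

/-- The `(m, n)`-leaper translation that maps the union of the sections `i` and `i + 1`
of the `(m, n)`-frame onto the union of the sections opposite them. -/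
def frameShift (m n : ℕ) : Dir → Square :=
  ![(-n, -m), (-m, -n), (m, -n), (n, -m), (n, m), (m, n), (-m, n), (-n, m)]

/-- The cyclic sequence of squares `D`, traversed counterclockwise, is proper within
the `(m, n)`-frame: it is a concatenation of eight nonempty paths `a 0`, …, `a 7`, one in each section,
such that the translation above maps `a i` followed by `a (i + 1)` onto
the reverse of `a (i + 5)` followed by the reverse of `a (i + 4)`. -/
def IsProperSeq (m n : ℕ) (D : List Square) : Prop :=
  ∃ a : Dir → List Square,
    D ~r (List.ofFn a).flatten ∧
    (∀ i, a i ≠ [] ∧ ∀ s ∈ a i, s ∈ frameSection m n i) ∧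
    ∀ i, (a i ++ a (i + 1)).map (· + frameShift m n i) = (a (i + 5)).reverse ++ (a (i + 4)).reverse

/-- The Hamiltonian cycle `w` of the `(r, s)`-leaper over `C`, traversed in either direction,
is proper within the `(m, n)`-frame. (The list `w.support.tail` has each square of `C` once.) -/
def IsProperTour (m n : ℕ) {r s : ℕ} {C : Set Square} {a : C}
    (w : (leaperGraphOn r s C).Walk a a) : Prop :=
  w.IsHamiltonianCycle ∧
    (IsProperSeq m n (w.support.tail.map Subtype.val) ∨
      IsProperSeq m n (w.support.tail.map Subtype.val).reverse)

/-! ### Even continued fractions -/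

/-- `c₁ ± 1 / (c₂ ± 1 / (… ± 1 / c_k))`, where `init` lists the terms `c₁`, …, `c_{k-1}`, each with
the sign that follows it, and `last` is `c_k`. -/
def cfValue (init : List (ℕ × ℤˣ)) (last : ℕ) : ℚ :=
  init.foldr (fun t x => (t.1 : ℚ) + ((t.2 : ℤ) : ℚ) / x) (last : ℚ)

/-- All terms are even and nonnegative, and all terms but the first one are positive. -/
def IsEvenCF (init : List (ℕ × ℤˣ)) (last : ℕ) : Prop :=
  (∀ c ∈ init.map Prod.fst ++ [last], Even c) ∧
    ∀ c ∈ (init.map Prod.fst ++ [last]).tail, 0 < c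

/-- `[c₁±, 2-, c₂±, 2-, …, c_k]`. -/
def interleavedValue (init : List (ℕ × ℤˣ)) (last : ℕ) : ℚ :=
  cfValue (init.flatMap fun t => [t, (2, -1)]) last

end Leaper

/-! The cycle obtained by lifting the `(1, 2)`-frame along the whole descent has its squares on a
closed path `D` of side-adjacent squares that runs once around the frame, with one path in each
section (`IsTrack`). For the `(1, 2)`-frame, `D` is the ring of eight squares. A lifting composes
each new path of translated copies, forward or reversed, of one, three or five consecutive old
paths.

The translations of neighbouring new sections differ by a move of the old leaper. By the translation
symmetry of the track, two reversed paths of one copy are therefore two forward paths of the other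
(`IsTrack.exchange`), and each junction of `D` lies in a copy of a piece of the old `D`. Hence
lifting preserves the translation symmetry (`IsTrack.shift_lift`), the fact that side-adjacent
squares are consecutive (`IsTrack.lift_tight`), and any symmetric translation-invariant relation
between squares `d` places apart (`IsTrack.spaced_lift`).

With `d = 1`, `D` is a Hamiltonian cycle of the `(0, 1)`-leaper, and by tightness the only one up to
start and direction. With `d = 3`, squares three places apart are a knight move apart, provided that
the first lifting is `g` or `h`: after a first lifting `f`, the ring of the `5 × 5` board has
straight runs where this fails.

If the paths have lengths `x` and `y`, then `D` has `4 (x + y)` squares. The lengths are coprime and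
`(x + y) / y` follows the interleaved continued fraction, so `x + y = l_k`, and steps of three visit
all of `D` when `3` does not divide `l_k`.

The squares form a leaper cycle because each has exactly two moves within the set and connectedness
survives lifting (`IsTrack.moveConnected_lift`). Uniqueness holds because only the oldest cycle
gains a type with every `g` and `h` (`CycleOfWord.le_depth`). -/

namespace Leaper

/-! ### Geometry of sections and lifting translations -/

/-- The directions of the sections of the smaller frame whose translations make up section `i`
of the larger frame, together with the hole or a part of it. -/
def Lifting.dirs (t : Lifting) (i : Dir) : List Dir :=
  match t, i.val % 2 with
  | .f, 0 => [i + 3, i + 4, i + 5]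
  | .f, _ => [i]
  | .g, 0 => [i]
  | .g, _ => [i + 3, i + 4, i + 5]
  | .h, 0 => [i + 2, i + 3, i + 4, i + 5, i + 6]
  | .h, _ => [i + 7, i, i + 1]

/-- The lifting of a system of paths, one in each section of the `(m, n)`-frame. -/
def Lifting.path (t : Lifting) (m n : ℕ) (a : Dir → List Square) (i : Dir) : List Square :=
  (match t, i.val % 2 with
  | .f, 0 => (a (i + 3) ++ a (i + 4) ++ a (i + 5)).reverse
  | .f, _ => a i
  | .g, 0 => a i
  | .g, _ => (a (i + 3) ++ a (i + 4) ++ a (i + 5)).reverse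
  | .h, 0 => (a (i + 2) ++ a (i + 3) ++ a (i + 4) ++ a (i + 5) ++ a (i + 6)).reverse
  | .h, _ => a (i + 7) ++ a i ++ a (i + 1)).map (· + t.shift m n i)

theorem strip_zero {m n : ℕ} {x : ℤ} : strip m n 0 x ↔ (m - n : ℤ) < 2 * x ∧ 2 * x < n - m := by
  rw [strip, if_pos rfl, abs_lt, neg_sub]

theorem strip_one {m n : ℕ} {x : ℤ} : strip m n 1 x ↔ (n - m : ℤ) < 2 * x ∧ 2 * x < m + n := by
  simp [strip]

theorem strip_neg_one {m n : ℕ} {x : ℤ} :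
    strip m n (-1) x ↔ 2 * x < (m - n : ℤ) ∧ -(m + n : ℤ) < 2 * x := by
  simp only [strip]
  norm_num
  omega

theorem mem_board {m n : ℕ} {s : Square} : s ∈ board m n ↔
    (-(m + n : ℤ) < 2 * s.1 ∧ 2 * s.1 < m + n) ∧ -(m + n : ℤ) < 2 * s.2 ∧ 2 * s.2 < m + n := by
  rw [board, Set.mem_ofPred_eq, abs_lt, abs_lt]

theorem eq_of_mem_frameSection {m n : ℕ} {s : Square} {i j : Dir} (hm : m < n)
    (hi : s ∈ frameSection m n i) (hj : s ∈ frameSection m n j) : i = j := by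
  obtain ⟨x, y⟩ := s
  fin_cases i <;> fin_cases j <;> first
    | rfl
    | (exfalso
       simp [frameSection, strip_zero, strip_one, strip_neg_one, dirVec] at hi hj
       omega)

theorem frameSection_subset_board {m n : ℕ} (hm : m < n) (i : Dir) :
    frameSection m n i ⊆ board m n := by
  rintro ⟨x, y⟩ hi
  fin_cases i <;> simp [frameSection, strip_zero, strip_one, strip_neg_one, dirVec, mem_board] at hi ⊢ <;> omega

theorem adjacent_sections {m n : ℕ} {s r : Square} {i j : Dir} (hm : m < n)
    (hodd : Odd (m + n)) (hi : s ∈ frameSection m n i) (hj : r ∈ frameSection m n j)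
    (h : IsMove 0 1 (r - s)) : j = i ∨ j = i + 1 ∨ j = i + 7 := by
  obtain ⟨x, y⟩ := s
  obtain ⟨z, w⟩ := r
  obtain ⟨k, hk⟩ := hodd
  simp only [IsMove, Prod.fst_sub, Prod.snd_sub] at h
  fin_cases i <;> fin_cases j <;> first
    | decide
    | (exfalso
       simp [frameSection, strip_zero, strip_one, strip_neg_one, dirVec] at hi hj
       omega)

/-- Every other move from section `i` leaves the board; nothing more is used about the endpoint. So
a square has at most two neighbours within the frame. -/
theorem move_sections {m n : ℕ} {s r : Square} {i j : Dir} (hm : 0 < m) (hmn : m < n)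
    (hi : s ∈ frameSection m n i) (hj : r ∈ frameSection m n j)
    (h : IsMove m n (r - s)) : r = s + frameShift m n i ∨ r = s + frameShift m n (i + 7) := by
  have hj := frameSection_subset_board hmn j hj
  obtain ⟨x, y⟩ := s
  obtain ⟨z, w⟩ := r
  simp only [IsMove, Prod.fst_sub, Prod.snd_sub] at h
  fin_cases i <;> simp [frameSection, strip_zero, strip_one, strip_neg_one, dirVec, mem_board, frameShift] at hi hj ⊢ <;> omega

set_option maxHeartbeats 2000000 in
-- A translated section lies inside section `i` of the larger frame or is disjoint from it, so a
-- lifting never cuts a path.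
theorem frameSection_add_shift (t : Lifting) {m n : ℕ} {s : Square} {i j : Dir} (hm : 0 < m)
    (hmn : m < n) (hj : s ∈ frameSection m n j) :
    s + t.shift m n i ∈ frameSection (t.target (m, n)).1 (t.target (m, n)).2 i ↔ j ∈ t.dirs i := by
  obtain ⟨x, y⟩ := s
  cases t <;> fin_cases i <;> fin_cases j <;>
    simp [frameSection, strip_zero, strip_one, strip_neg_one, dirVec, Lifting.target,
      Lifting.shift, Lifting.dirs] at hj ⊢ <;>
    omega

/-- Consequently two copies of one square, in sections `i` and `i + 5` of the larger frame, are a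
move of the larger leaper apart. -/
theorem Lifting.shift_add_frameShift (t : Lifting) {m n : ℕ} (hmn : m < n) (i : Dir) :
    t.shift m n i + frameShift (t.target (m, n)).1 (t.target (m, n)).2 i = t.shift m n (i + 5) := by
  cases t <;> fin_cases i <;>
    simp [Lifting.target, Lifting.shift, frameShift, dirVec] <;> omega

theorem Lifting.shift_succ_add_frameShift (t : Lifting) {m n : ℕ} (hmn : m < n) (i : Dir) :
    t.shift m n (i + 1) + frameShift (t.target (m, n)).1 (t.target (m, n)).2 i =
      t.shift m n (i + 4) := by
  cases t <;> fin_cases i <;>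
    simp [Lifting.target, Lifting.shift, frameShift, dirVec] <;> omega

/-- The translations of neighbouring new sections differ by a move of the smaller leaper. This and
the next five identities are the input of `IsTrack.exchange`. -/
theorem Lifting.g_shift_even {m n : ℕ} {i : Dir} (hi : i.val % 2 = 0) :
    Lifting.g.shift m n (i + 1) = frameShift m n (i + 5) + Lifting.g.shift m n i := by
  fin_cases i <;> simp at hi <;> simp [Lifting.shift, frameShift, dirVec] <;> ring

theorem Lifting.g_shift_odd {m n : ℕ} {i : Dir} (hi : i.val % 2 = 1) :
    Lifting.g.shift m n i = frameShift m n (i + 3) + Lifting.g.shift m n (i + 1) := by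
  fin_cases i <;> simp at hi <;> simp [Lifting.shift, frameShift, dirVec] <;> ring

theorem Lifting.f_shift_odd {m n : ℕ} {i : Dir} (hi : i.val % 2 = 1) :
    Lifting.f.shift m n (i + 1) = frameShift m n (i + 5) + Lifting.f.shift m n i := by
  fin_cases i <;> simp at hi <;> simp [Lifting.shift, frameShift, dirVec] <;> omega

theorem Lifting.f_shift_even {m n : ℕ} {i : Dir} (hi : i.val % 2 = 0) :
    Lifting.f.shift m n i = frameShift m n (i + 3) + Lifting.f.shift m n (i + 1) := by
  fin_cases i <;> simp at hi <;> simp [Lifting.shift, frameShift, dirVec] <;> omega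

theorem Lifting.h_shift_odd {m n : ℕ} {i : Dir} (hi : i.val % 2 = 1) :
    Lifting.h.shift m n (i + 1) = frameShift m n (i + 6) + Lifting.h.shift m n i := by
  fin_cases i <;> simp at hi <;> simp [Lifting.shift, frameShift, dirVec] <;> omega

theorem Lifting.h_shift_even {m n : ℕ} {i : Dir} (hi : i.val % 2 = 0) :
    Lifting.h.shift m n i = frameShift m n (i + 2) + Lifting.h.shift m n (i + 1) := by
  fin_cases i <;> simp at hi <;> simp [Lifting.shift, frameShift, dirVec] <;> omega

/-- Of the three or five reversed paths that make up the new path `i`, the last two are covered by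
`IsTrack.exchange`. The directions `j` listed here are those of the others, which are too far from
section `i + 1`. The next lemma is the mirror image. -/
theorem Lifting.not_adj_left (t : Lifting) {m n : ℕ} {u v : Square} {i j : Dir} (hmn : m < n)
    (ht : t = .g ∧ i.val % 2 = 1 ∧ j = i + 5 ∨ t = .f ∧ i.val % 2 = 0 ∧ j = i + 5 ∨
      t = .h ∧ i.val % 2 = 0 ∧ (j = i + 4 ∨ j = i + 5 ∨ j = i + 6))
    (hu : u ∈ frameSection m n j)
    (hv : v ∈ frameSection (t.target (m, n)).1 (t.target (m, n)).2 (i + 1)) :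
    ¬ IsMove 0 1 (v - (u + t.shift m n i)) := by
  obtain ⟨x, y⟩ := u
  obtain ⟨z, w⟩ := v
  rcases ht with ⟨rfl, hi, rfl⟩ | ⟨rfl, hi, rfl⟩ | ⟨rfl, hi, rfl | rfl | rfl⟩ <;>
    fin_cases i <;> simp at hi <;>
    simp [frameSection, strip_zero, strip_one, strip_neg_one, dirVec, Lifting.target,
      Lifting.shift, IsMove] at hu hv ⊢ <;>
    omega

theorem Lifting.not_adj_right (t : Lifting) {m n : ℕ} {u v : Square} {i j : Dir} (hmn : m < n)
    (ht : t = .g ∧ i.val % 2 = 0 ∧ j = i + 4 ∨ t = .f ∧ i.val % 2 = 1 ∧ j = i + 4 ∨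
      t = .h ∧ i.val % 2 = 1 ∧ (j = i + 3 ∨ j = i + 4 ∨ j = i + 5))
    (hu : u ∈ frameSection (t.target (m, n)).1 (t.target (m, n)).2 i)
    (hv : v ∈ frameSection m n j) :
    ¬ IsMove 0 1 (v + t.shift m n (i + 1) - u) := by
  obtain ⟨x, y⟩ := u
  obtain ⟨z, w⟩ := v
  rcases ht with ⟨rfl, hi, rfl⟩ | ⟨rfl, hi, rfl⟩ | ⟨rfl, hi, rfl | rfl | rfl⟩ <;>
    fin_cases i <;> simp at hi <;>
    simp [frameSection, strip_zero, strip_one, strip_neg_one, dirVec, Lifting.target,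
      Lifting.shift, IsMove] at hu hv ⊢ <;>
    omega

/-! ### Local properties of lists -/

/-- Any two elements of the list at distance `d` are related by `R`, in the order of the list. -/
def Spaced {α : Type*} (d : ℕ) (R : α → α → Prop) (l : List α) : Prop :=
  ∀ k u v, l[k]? = some u → l[k + d]? = some v → R u v

namespace Spaced
variable {α : Type*} {d : ℕ} {R : α → α → Prop} {l A B C : List α}

/-- Two elements at distance `d` cannot straddle a middle part of length at least `d`, so both lie
in `A ++ B` or both in `B ++ C`. -/
theorem glue (hB : d ≤ B.length) (h₁ : Spaced d R (A ++ B)) (h₂ : Spaced d R (B ++ C)) :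
    Spaced d R (A ++ B ++ C) := by
  intro k u v hu hv
  by_cases hk : k + d < A.length + B.length
  · refine h₁ k u v ?_ ?_
    · rwa [List.getElem?_append_left (by simp; omega)] at hu
    · rwa [List.getElem?_append_left (by simp; omega)] at hv
  · rw [List.append_assoc, List.getElem?_append_right (by omega)] at hu hv
    refine h₂ (k - A.length) u v hu ?_
    rwa [show k - A.length + d = k + d - A.length by omega]

theorem left (h : Spaced d R (A ++ B)) : Spaced d R A := by
  intro k u v hu hv
  refine h k u v ?_ ?_
  · rwa [List.getElem?_append_left (List.getElem?_eq_some_iff.1 hu).1]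
  · rwa [List.getElem?_append_left (List.getElem?_eq_some_iff.1 hv).1]

theorem reverse (hR : ∀ u v, R u v → R v u) (h : Spaced d R l) : Spaced d R l.reverse := by
  intro k u v hu hv
  have hk := (List.getElem?_eq_some_iff.1 hv).1
  rw [List.length_reverse] at hk
  rw [List.getElem?_reverse (by omega)] at hu hv
  refine hR _ _ (h (l.length - 1 - (k + d)) v u hv ?_)
  rwa [show l.length - 1 - (k + d) + d = l.length - 1 - k by omega]

theorem map {f : α → α} (hR : ∀ u v, R u v → R (f u) (f v)) (h : Spaced d R l) :
    Spaced d R (l.map f) := by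
  intro k u v hu hv
  rw [List.getElem?_map, Option.map_eq_some_iff] at hu hv
  obtain ⟨u', hu, rfl⟩ := hu
  obtain ⟨v', hv, rfl⟩ := hv
  exact hR _ _ (h k u' v' hu hv)

end Spaced

/-- `u` and `v` are consecutive elements of the list. -/
def Consec {α : Type*} (l : List α) (u v : α) : Prop :=
  ∃ k : ℕ, l[k]? = some u ∧ l[k + 1]? = some v

namespace Consec
variable {α : Type*} {l A B : List α} {u v : α}

theorem append_right (h : Consec A u v) : Consec (A ++ B) u v := by
  obtain ⟨k, hu, hv⟩ := h
  refine ⟨k, ?_, ?_⟩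
  · rwa [List.getElem?_append_left (List.getElem?_eq_some_iff.1 hu).1]
  · rwa [List.getElem?_append_left (List.getElem?_eq_some_iff.1 hv).1]

theorem append_left (h : Consec B u v) : Consec (A ++ B) u v := by
  obtain ⟨k, hu, hv⟩ := h
  refine ⟨A.length + k, ?_, ?_⟩
  · rwa [List.getElem?_append_right (by omega), Nat.add_sub_cancel_left]
  · rwa [List.getElem?_append_right (by omega),
      show A.length + k + 1 - A.length = k + 1 by omega]

theorem reverse (h : Consec l u v) : Consec l.reverse v u := by
  obtain ⟨k, hu, hv⟩ := h
  have hk := (List.getElem?_eq_some_iff.1 hv).1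
  refine ⟨l.length - 1 - (k + 1), ?_, ?_⟩
  · rw [List.getElem?_reverse (by omega)]
    rwa [show l.length - 1 - (l.length - 1 - (k + 1)) = k + 1 by omega]
  · rw [List.getElem?_reverse (by omega)]
    rwa [show l.length - 1 - (l.length - 1 - (k + 1) + 1) = k by omega]

theorem map {β : Type*} (f : α → β) (h : Consec l u v) : Consec (l.map f) (f u) (f v) := by
  obtain ⟨k, hu, hv⟩ := h
  exact ⟨k, by simp [hu], by simp [hv]⟩

end Consec

/-- Any two elements of the list that are related by `R` are consecutive. -/
def Tight {α : Type*} (R : α → α → Prop) (l : List α) : Prop :=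
  ∀ u ∈ l, ∀ v ∈ l, R u v → Consec l u v ∨ Consec l v u

namespace Tight
variable {α : Type*} {R : α → α → Prop} {l A B : List α}

theorem reverse (h : Tight R l) : Tight R l.reverse := fun u hu v hv huv =>
  (h u (List.mem_reverse.1 hu) v (List.mem_reverse.1 hv) huv).symm.imp .reverse .reverse

theorem map {f : α → α} (hR : ∀ u v, R (f u) (f v) → R u v) (h : Tight R l) :
    Tight R (l.map f) := by
  intro u hu v hv huv
  obtain ⟨u', hu', rfl⟩ := List.mem_map.1 hu
  obtain ⟨v', hv', rfl⟩ := List.mem_map.1 hv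
  exact (h u' hu' v' hv' (hR _ _ huv)).imp (.map f) (.map f)

theorem append (hR : ∀ u v, R u v → R v u) (hA : Tight R A) (hB : Tight R B)
    (hAB : ∀ u ∈ A, ∀ v ∈ B, R u v → Consec (A ++ B) u v ∨ Consec (A ++ B) v u) :
    Tight R (A ++ B) := by
  intro u hu v hv huv
  rcases List.mem_append.1 hu with hu | hu <;> rcases List.mem_append.1 hv with hv | hv
  · exact (hA u hu v hv huv).imp .append_right .append_right
  · exact hAB u hu v hv huv
  · exact (hAB v hv u hu (hR _ _ huv)).symm
  · exact (hB u hu v hv huv).imp .append_left .append_left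

end Tight

/-! ### Tracks and lifted paths -/

/-- The concatenation of the paths in `k` consecutive directions, the first one being `i`. -/
def arc {α : Type*} (a : Dir → List α) (i : Dir) : ℕ → List α
  | 0 => []
  | k + 1 => a i ++ arc a (i + 1) k

open scoped Fin.CommRing in
theorem arc_add {α : Type*} (a : Dir → List α) (i : Dir) (k l : ℕ) :
    arc a i (k + l) = arc a i k ++ arc a (i + (k : Fin 8)) l := by
  induction k generalizing i with
  | zero => simp [arc]
  | succ k ih =>
    rw [Nat.add_right_comm, arc, ih, arc, List.append_assoc]
    congr 3
    push_cast
    rw [add_assoc, add_comm 1 (k : Fin 8)]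

open scoped Fin.CommRing in
theorem mem_arc {α : Type*} {a : Dir → List α} {i : Dir} {k : ℕ} {s : α} :
    s ∈ arc a i k ↔ ∃ l < k, s ∈ a (i + (l : Fin 8)) := by
  induction k generalizing i with
  | zero => simp [arc]
  | succ k ih =>
    rw [arc, List.mem_append, ih]
    constructor
    · rintro (h | ⟨l, hl, h⟩)
      · exact ⟨0, by omega, by simpa using h⟩
      · exact ⟨l + 1, by omega, by
          push_cast
          rwa [add_comm (l : Fin 8), ← add_assoc]⟩
    · rintro ⟨l, hl, h⟩
      cases l with
      | zero => exact .inl (by simpa using h)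
      | succ l =>
        refine .inr ⟨l, by omega, ?_⟩
        push_cast at h
        rwa [add_comm (l : Fin 8), ← add_assoc] at h

/-- The squares `u` and `v` are adjacent by side. -/
def Step (u v : Square) : Prop := IsMove 0 1 (v - u)

theorem Step.symm {u v : Square} (h : Step u v) : Step v u := by
  simp only [Step, IsMove, Prod.fst_sub, Prod.snd_sub] at h ⊢
  omega

theorem step_add_right {u v : Square} (w : Square) : Step (u + w) (v + w) ↔ Step u v := by
  rw [Step, Step, add_sub_add_right_eq_sub]

/-- The translation of a list of squares by a vector. -/
def translate (v : Square) (l : List Square) : List Square := l.map (· + v)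

@[simp] theorem translate_append (v : Square) (l l' : List Square) :
    translate v (l ++ l') = translate v l ++ translate v l' := List.map_append

@[simp] theorem translate_reverse (v : Square) (l : List Square) :
    translate v l.reverse = (translate v l).reverse := List.map_reverse

@[simp] theorem translate_translate (v w : Square) (l : List Square) :
    translate w (translate v l) = translate (v + w) l := by
  simp [translate, Function.comp_def, add_assoc]

@[simp] theorem length_translate (v : Square) (l : List Square) :
    (translate v l).length = l.length := List.length_map _

theorem mem_translate {v s : Square} {l : List Square} : s ∈ translate v l ↔ s - v ∈ l := by
  simp only [translate, List.mem_map]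
  exact ⟨by rintro ⟨c, hc, rfl⟩; simpa using hc, fun h => ⟨_, h, sub_add_cancel _ _⟩⟩

/-- A system of paths, one in each section of the `(m, n)`-frame, of lengths `x` and `y` in
the sections to the sides and at the corners of the hole, respectively, that is invariant under the
translations of opposite sections, and whose squares are adjacent only along the paths. -/
structure IsTrack (m n x y : ℕ) (a : Dir → List Square) : Prop where
  pos_x : 0 < x
  pos_y : 0 < y
  length_even : ∀ i : Dir, i.val % 2 = 0 → (a i).length = x
  length_odd : ∀ i : Dir, i.val % 2 = 1 → (a i).length = y
  mem : ∀ i, ∀ s ∈ a i, s ∈ frameSection m n i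
  nodup : ∀ i, (a i).Nodup
  shift : ∀ i, translate (frameShift m n i) (a i ++ a (i + 1)) =
    (a (i + 5)).reverse ++ (a (i + 4)).reverse
  tight : ∀ i, Tight Step (a i ++ a (i + 1))

theorem succ_mod_two_of_even {i : Dir} (hi : i.val % 2 = 0) : (i + 1).val % 2 = 1 := by
  revert i; decide

theorem succ_mod_two_of_odd {i : Dir} (hi : i.val % 2 = 1) : (i + 1).val % 2 = 0 := by
  revert i; decide

section path
variable {m n : ℕ} {a : Dir → List Square} {i : Dir}

theorem path_f_even (hi : i.val % 2 = 0) : Lifting.f.path m n a i =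
    translate (Lifting.f.shift m n i) (a (i + 3) ++ a (i + 4) ++ a (i + 5)).reverse := by
  simp [Lifting.path, hi, translate]

theorem path_f_odd (hi : i.val % 2 = 1) : Lifting.f.path m n a i =
    translate (Lifting.f.shift m n i) (a i) := by
  simp [Lifting.path, hi, translate]

theorem path_g_odd (hi : i.val % 2 = 1) : Lifting.g.path m n a i =
    translate (Lifting.g.shift m n i) (a (i + 3) ++ a (i + 4) ++ a (i + 5)).reverse := by
  simp [Lifting.path, hi, translate]

theorem path_g_even (hi : i.val % 2 = 0) : Lifting.g.path m n a i =
    translate (Lifting.g.shift m n i) (a i) := by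
  simp [Lifting.path, hi, translate]

theorem path_h_odd (hi : i.val % 2 = 1) : Lifting.h.path m n a i =
    translate (Lifting.h.shift m n i) (a (i + 7) ++ a i ++ a (i + 1)) := by
  simp [Lifting.path, hi, translate]

theorem path_h_even (hi : i.val % 2 = 0) : Lifting.h.path m n a i =
    translate (Lifting.h.shift m n i)
      (a (i + 2) ++ a (i + 3) ++ a (i + 4) ++ a (i + 5) ++ a (i + 6)).reverse := by
  simp [Lifting.path, hi, translate]

theorem mem_path {t : Lifting} {s : Square} :
    s ∈ t.path m n a i ↔ ∃ j ∈ t.dirs i, s - t.shift m n i ∈ a j := by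
  rcases Nat.mod_two_eq_zero_or_one i.val with hi | hi <;> cases t
  · simp [path_f_even hi, Lifting.dirs, hi, mem_translate, or_comm, or_assoc]
  · simp [path_g_even hi, Lifting.dirs, hi, mem_translate]
  · simp [path_h_even hi, Lifting.dirs, hi, mem_translate, or_comm, or_assoc]
  · simp [path_f_odd hi, Lifting.dirs, hi, mem_translate]
  · simp [path_g_odd hi, Lifting.dirs, hi, mem_translate, or_comm, or_assoc]
  · simp [path_h_odd hi, Lifting.dirs, hi, mem_translate]

end path

namespace IsTrack
variable {m n x y : ℕ} {a : Dir → List Square} {i : Dir}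

theorem length_pair (T : IsTrack m n x y a) (i : Dir) :
    (a i).length + (a (i + 1)).length = x + y := by
  rcases Nat.mod_two_eq_zero_or_one i.val with hi | hi
  · rw [T.length_even i hi, T.length_odd _ (succ_mod_two_of_even hi)]
  · rw [T.length_odd i hi, T.length_even _ (succ_mod_two_of_odd hi), add_comm]

theorem ne_nil (T : IsTrack m n x y a) (i : Dir) : a i ≠ [] := by
  rw [← List.length_pos_iff]
  rcases Nat.mod_two_eq_zero_or_one i.val with hi | hi
  · exact T.length_even i hi ▸ T.pos_x
  · exact T.length_odd i hi ▸ T.pos_y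

/-- Two copies of the track whose translations differ by a leaper move overlap in two paths,
traversed in opposite directions. At a junction of lifted paths, this turns the end of one copy into
a prolongation of the other. -/
theorem exchange (T : IsTrack m n x y a) (j : Dir) {v w : Square}
    (h : w = frameShift m n j + v) :
    (translate w (a (j + 1))).reverse ++ (translate w (a j)).reverse =
      translate v (a (j + 4)) ++ translate v (a (j + 5)) := by
  have := congrArg (fun l => (translate v l).reverse) (T.shift j)
  simp only [translate_translate, ← h] at this
  simpa using this

theorem exchange_append (T : IsTrack m n x y a) (j : Dir) {v w : Square}
    (h : w = frameShift m n j + v) (l : List Square) :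
    (translate w (a (j + 1))).reverse ++ ((translate w (a j)).reverse ++ l) =
      translate v (a (j + 4)) ++ (translate v (a (j + 5)) ++ l) := by
  rw [← List.append_assoc, T.exchange j h, List.append_assoc]

/-- By the identities `h0` and `h1`, both sides are made of copies with the translations of sections
`i + 5` and `i + 4`. Their outer paths coincide, and the middle pair is matched by `exchange`. -/
theorem shift_lift (T : IsTrack m n x y a) (hmn : m < n) (t : Lifting) (i : Dir) :
    translate (frameShift (t.target (m, n)).1 (t.target (m, n)).2 i)
      (t.path m n a i ++ t.path m n a (i + 1)) =
    (t.path m n a (i + 5)).reverse ++ (t.path m n a (i + 4)).reverse := by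
  have h0 := t.shift_add_frameShift hmn i
  have h1 := t.shift_succ_add_frameShift hmn i
  have hpar (hi : i.val % 2 = 0) : (i + 4).val % 2 = 0 ∧ (i + 5).val % 2 = 1 := by
    clear * - hi; revert i; decide
  have hpar' (hi : i.val % 2 = 1) : (i + 4).val % 2 = 1 ∧ (i + 5).val % 2 = 0 := by
    clear * - hi; revert i; decide
  -- Opposite sections have opposite translations, which carries the identities for `i` and `i + 1`
  -- over to `i + 4` and `i + 5`.
  have e4 (j : Dir) : t.shift m n (j + 4) = - t.shift m n j := by
    cases t <;> fin_cases j <;> simp [Lifting.shift, dirVec]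
  rcases Nat.mod_two_eq_zero_or_one i.val with hi | hi
  · have hi1 := succ_mod_two_of_even hi
    obtain ⟨hi4, hi5⟩ := hpar hi
    cases t
    · rw [path_f_even hi, path_f_odd hi1, path_f_even hi4, path_f_odd hi5]
      have := T.exchange_append (i + 3) (v := Lifting.f.shift m n (i + 4))
        (w := Lifting.f.shift m n (i + 5)) (by
          have := Lifting.f_shift_even (m := m) (n := n) hi
          rw [e4, show i + 5 = i + 1 + 4 by rw [add_assoc]; rfl, e4, this]; abel)
      simp only [add_assoc, Fin.reduceAdd, add_zero] at this ⊢
      simp [h0, h1, this]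
    · rw [path_g_even hi, path_g_odd hi1, path_g_even hi4, path_g_odd hi5]
      have := T.exchange_append (i + 5) (w := Lifting.g.shift m n (i + 4))
        (v := Lifting.g.shift m n (i + 5)) (by
          have := Lifting.g_shift_even (m := m) (n := n) hi
          rw [e4, show i + 5 = i + 1 + 4 by rw [add_assoc]; rfl, e4, this, add_assoc]
          simp only [Fin.reduceAdd]; abel)
      simp only [add_assoc, Fin.reduceAdd, add_zero] at this ⊢
      simp [h0, h1, this]
    · rw [path_h_even hi, path_h_odd hi1, path_h_even hi4, path_h_odd hi5]
      have := T.exchange_append (i + 2) (v := Lifting.h.shift m n (i + 4))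
        (w := Lifting.h.shift m n (i + 5)) (by
          have := Lifting.h_shift_even (m := m) (n := n) hi
          rw [e4, show i + 5 = i + 1 + 4 by rw [add_assoc]; rfl, e4, this]; abel)
      simp only [add_assoc, Fin.reduceAdd, add_zero] at this ⊢
      simp [h0, h1, this]
  · have hi1 := succ_mod_two_of_odd hi
    obtain ⟨hi4, hi5⟩ := hpar' hi
    cases t
    · rw [path_f_odd hi, path_f_even hi1, path_f_odd hi4, path_f_even hi5]
      have := T.exchange_append (i + 5) (w := Lifting.f.shift m n (i + 4))
        (v := Lifting.f.shift m n (i + 5)) (by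
          have := Lifting.f_shift_odd (m := m) (n := n) hi
          rw [e4, show i + 5 = i + 1 + 4 by rw [add_assoc]; rfl, e4, this, add_assoc]
          simp only [Fin.reduceAdd]; abel)
      simp only [add_assoc, Fin.reduceAdd, add_zero] at this ⊢
      simp [h0, h1, this]
    · rw [path_g_odd hi, path_g_even hi1, path_g_odd hi4, path_g_even hi5]
      have := T.exchange_append (i + 3) (v := Lifting.g.shift m n (i + 4))
        (w := Lifting.g.shift m n (i + 5)) (by
          have := Lifting.g_shift_odd (m := m) (n := n) hi
          rw [e4, show i + 5 = i + 1 + 4 by rw [add_assoc]; rfl, e4, this]; abel)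
      simp only [add_assoc, Fin.reduceAdd, add_zero] at this ⊢
      simp [h0, h1, this]
    · rw [path_h_odd hi, path_h_even hi1, path_h_odd hi4, path_h_even hi5]
      have := T.exchange_append (i + 6) (w := Lifting.h.shift m n (i + 4))
        (v := Lifting.h.shift m n (i + 5)) (by
          have := Lifting.h_shift_odd (m := m) (n := n) hi
          rw [e4, show i + 5 = i + 1 + 4 by rw [add_assoc]; rfl, e4, this]; abel)
      simp only [add_assoc, Fin.reduceAdd, add_zero] at this ⊢
      simp [h0, h1, this]

end IsTrack
-- Arcs of a track and of its lifting
theorem Tight.glue {α : Type*} {R : α → α → Prop} {A B C : List α} (hR : ∀ u v, R u v → R v u)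
    (h₁ : Tight R (A ++ B)) (h₂ : Tight R (B ++ C)) (h : ∀ u ∈ A, ∀ v ∈ C, ¬ R u v) :
    Tight R (A ++ B ++ C) := by
  have aux : ∀ u ∈ A ++ B ++ C, ∀ v ∈ A ++ B ++ C, R u v →
      (u ∈ A ++ B ∧ v ∈ A ++ B) ∨ (u ∈ B ++ C ∧ v ∈ B ++ C) := by
    intro u hu v hv huv
    have h1 := h u
    have h2 := h v
    have h3 := hR u v huv
    simp only [List.mem_append] at hu hv ⊢
    grind
  intro u hu v hv huv
  rcases aux u hu v hv huv with ⟨hu, hv⟩ | ⟨hu, hv⟩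
  · exact (h₁ u hu v hv huv).imp .append_right .append_right
  · rw [List.append_assoc]
    exact (h₂ u hu v hv huv).imp .append_left .append_left

theorem Tight.translate {l : List Square} (h : Tight Step l) (w : Square) :
    Tight Step (translate w l) :=
  Tight.map (fun _ _ => (step_add_right w).1) h

theorem Spaced.translate {d : ℕ} {R : Square → Square → Prop} {l : List Square}
    (hR : ∀ w u v, R u v → R (u + w) (v + w)) (h : Spaced d R l) (w : Square) :
    Spaced d R (translate w l) :=
  Spaced.map (hR w) h

namespace IsTrack
variable {m n x y : ℕ} {a : Dir → List Square}

theorem nodup_arc (T : IsTrack m n x y a) (hmn : m < n) {k : ℕ} (hk : k ≤ 8) (i : Dir) :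
    (arc a i k).Nodup := by
  induction k generalizing i with
  | zero => simp [arc]
  | succ k ih =>
    rw [arc, List.nodup_append']
    refine ⟨T.nodup i, ih (by omega) _, ?_⟩
    intro s hs hs'
    obtain ⟨l, hl, hs'⟩ := mem_arc.1 hs'
    have := eq_of_mem_frameSection hmn (T.mem _ _ hs) (T.mem _ _ hs')
    have h8 : ∀ i : Fin 8, ∀ l : Fin 7, i ≠ i + 1 + Fin.ofNat 8 l.val := by decide
    exact h8 i ⟨l, by omega⟩ this

/-- Only equal or neighbouring sections contain adjacent squares, so tightness of pairs suffices.
Seven is the limit because sections `i` and `i + 7` are neighbours again. -/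
theorem tight_arc (T : IsTrack m n x y a) (hmn : m < n) (hodd : Odd (m + n)) {k : ℕ}
    (hk : k ≤ 7) (i : Dir) : Tight Step (arc a i k) := by
  have h1 (i : Dir) : Tight Step (a i) := by
    intro u hu v hv huv
    have hn := (T.nodup_arc hmn (k := 2) (by omega) i)
    simp only [arc, List.append_nil] at hn
    have key : ∀ u ∈ a i, ∀ v ∈ a i, Consec (a i ++ a (i + 1)) u v → Consec (a i) u v := by
      rintro u hu v hv ⟨k, h, h'⟩
      have hk : k + 1 < (a i).length := by
        by_contra hk
        have := List.mem_of_getElem? ((List.getElem?_append_right (by omega)).symm.trans h')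
        exact (List.nodup_append'.1 hn).2.2 hv this
      exact ⟨k, by rwa [List.getElem?_append_left (by omega)] at h,
        by rwa [List.getElem?_append_left (by omega)] at h'⟩
    exact (T.tight i u (List.mem_append_left _ hu) v (List.mem_append_left _ hv) huv).imp
      (key u hu v hv) (key v hv u hu)
  induction k generalizing i with
  | zero => simp [arc, Tight]
  | succ k ih =>
    rw [arc]
    refine Tight.append (fun _ _ => Step.symm) (h1 i) (ih (by omega) _) ?_
    intro u hu v hv huv
    obtain ⟨l, hl, hv'⟩ := mem_arc.1 hv
    have h8 : ∀ i : Fin 8, ∀ l : Fin 6, (i + 1 + Fin.ofNat 8 l.val = i ∨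
        i + 1 + Fin.ofNat 8 l.val = i + 1 ∨ i + 1 + Fin.ofNat 8 l.val = i + 7) → l = 0 := by
      decide
    have hl0 := h8 i ⟨l, by omega⟩
      (adjacent_sections hmn hodd (T.mem _ _ hu) (T.mem _ _ hv') huv)
    obtain rfl : l = 0 := by simpa using hl0
    obtain ⟨k, rfl⟩ : ∃ k', k = k' + 1 := ⟨k - 1, by omega⟩
    rw [arc, ← List.append_assoc]
    simp only [Nat.cast_zero, add_zero] at hv'
    exact (T.tight i u (List.mem_append_left _ hu) v (List.mem_append_right _ hv') huv).imp
      .append_right .append_right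

variable {d : ℕ} {R : Square → Square → Prop}

/-- Arcs of three paths overlap in two paths, which have `x + y ≥ d` squares in all, so they glue to
arcs of any length. -/
theorem spaced_arc (T : IsTrack m n x y a) (hd : d ≤ x + y)
    (H : ∀ i, Spaced d R (arc a i 3)) (k : ℕ) (i : Dir) : Spaced d R (arc a i k) := by
  induction k generalizing i with
  | zero => exact (H i).left (A := arc a i 0) (B := arc a i 3)
  | succ k ih =>
    by_cases hk : k + 1 ≤ 3
    · have := H i
      rw [show 3 = (k + 1) + (2 - k) by omega, arc_add] at this
      exact this.left
    · obtain ⟨k, rfl⟩ : ∃ k', k = k' + 2 := ⟨k - 2, by omega⟩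
      have h1 := H i
      have h2 := ih (i + 1)
      simp only [arc, List.append_nil] at h1 h2 ⊢
      rw [← List.append_assoc] at h2
      rw [← List.append_assoc (a (i + 1)), ← List.append_assoc]
      refine Spaced.glue ?_ h1 h2
      rw [List.length_append, T.length_pair]
      exact hd

section spaced
variable (T : IsTrack m n x y a) (hsymm : ∀ u v, R u v → R v u)
  (htr : ∀ w u v, R u v → R (u + w) (v + w)) (hd : d ≤ x + y)
  (H : ∀ k i, Spaced d R (arc a i k)) (i : Dir) {v₀ v₁ v₂ : Square}
include T hsymm htr hd H

/-- Three consecutive new paths consist of 1, 3, 1 or 3, 1, 3 old ones for `f` and `g`, and of 5, 3,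
5 or 3, 5, 3 for `h`; there is one lemma for each pattern. By `exchange`, each junction lies inside
a copy of an old arc, and successive copies overlap in at least two paths. -/
theorem spaced_one_three (h₀ : v₁ = frameShift m n (i + 5) + v₀)
    (h₂ : v₁ = frameShift m n (i + 4) + v₂) :
    Spaced d R (translate v₀ (a i) ++ (translate v₁ (a (i + 4) ++ a (i + 5) ++ a (i + 6)).reverse
      ++ translate v₂ (a (i + 2)))) := by
  have e₀ := T.exchange (i + 5) h₀
  have e₂ := T.exchange (i + 4) h₂
  have s₀ := (H 3 i).translate htr v₀
  have s₁ := ((H 3 (i + 4)).translate htr v₁).reverse hsymm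
  have s₂ := (H 3 i).translate htr v₂
  have l₀ := T.length_pair (i + 4)
  have l₁ := T.length_pair (i + 5)
  simp only [arc, add_assoc, Fin.reduceAdd, add_zero, translate_append, List.append_nil,
    List.reverse_append, translate_reverse] at *
  rw [← e₀] at s₀
  rw [← List.append_assoc, ← e₂] at s₂
  have := Spaced.glue (d := d) (A := (translate v₁ (a (i + 6))).reverse)
    (B := (translate v₁ (a (i + 5))).reverse ++ (translate v₁ (a (i + 4))).reverse)
    (by simp; omega) (by simpa only [List.append_assoc] using s₁) s₂
  have := Spaced.glue (d := d) (A := translate v₀ (a i))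
    (B := (translate v₁ (a (i + 6))).reverse ++ (translate v₁ (a (i + 5))).reverse)
    (by simp; omega) s₀ (by simpa only [List.append_assoc] using this)
  simpa only [List.append_assoc] using this

theorem spaced_three_one (h₀ : v₀ = frameShift m n (i + 3) + v₁)
    (h₂ : v₂ = frameShift m n (i + 6) + v₁) :
    Spaced d R (translate v₀ (a (i + 3) ++ a (i + 4) ++ a (i + 5)).reverse ++
      (translate v₁ (a (i + 1)) ++
        translate v₂ (a (i + 5) ++ a (i + 6) ++ a (i + 7)).reverse)) := by
  have e₀ := T.exchange_append (i + 3) h₀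
  have e₂ := T.exchange (i + 6) h₂
  have s₀ := ((H 3 (i + 3)).translate htr v₀).reverse hsymm
  -- The middle path alone may be shorter than `d`, so the copied arc must reach across both
  -- junctions.
  have s₁ := (H 5 (i + 7)).translate htr v₁
  have s₂ := ((H 3 (i + 5)).translate htr v₂).reverse hsymm
  have l₀ := T.length_pair (i + 3)
  have l₁ := T.length_pair (i + 6)
  simp only [arc, add_assoc, Fin.reduceAdd, add_zero, translate_append, List.append_nil,
    List.reverse_append, translate_reverse] at *
  rw [← e₂] at s₁
  have := Spaced.glue (d := d) (A := translate v₁ (a (i + 7)) ++ translate v₁ (a i) ++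
      translate v₁ (a (i + 1)))
    (B := (translate v₂ (a (i + 7))).reverse ++ (translate v₂ (a (i + 6))).reverse)
    (by simp; omega) (by simpa only [List.append_assoc] using s₁)
    (by simpa only [List.append_assoc] using s₂)
  have := Spaced.glue (d := d) (A := (translate v₀ (a (i + 5))).reverse)
    (B := (translate v₀ (a (i + 4))).reverse ++ (translate v₀ (a (i + 3))).reverse)
    (by simp; omega) (by simpa only [List.append_assoc] using s₀)
    (by simpa only [List.append_assoc, e₀] using this)
  simpa only [List.append_assoc] using this

theorem spaced_five_three (h₀ : v₀ = frameShift m n (i + 2) + v₁)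
    (h₂ : v₂ = frameShift m n (i + 7) + v₁) :
    Spaced d R (translate v₀ (a (i + 2) ++ a (i + 3) ++ a (i + 4) ++ a (i + 5) ++ a (i + 6)).reverse
      ++ (translate v₁ (a i ++ a (i + 1) ++ a (i + 2)) ++
        translate v₂ (a (i + 4) ++ a (i + 5) ++ a (i + 6) ++ a (i + 7) ++ a i).reverse)) := by
  have e₀ := T.exchange_append (i + 2) h₀
  have e₂ := T.exchange (i + 7) h₂
  have s₀ := ((H 5 (i + 2)).translate htr v₀).reverse hsymm
  have s₁ := (H 7 (i + 6)).translate htr v₁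
  have s₂ := ((H 5 (i + 4)).translate htr v₂).reverse hsymm
  have l₀ := T.length_pair (i + 2)
  have l₁ := T.length_pair (i + 7)
  simp only [arc, add_assoc, Fin.reduceAdd, add_zero, translate_append, List.append_nil,
    List.reverse_append, translate_reverse] at *
  rw [← e₂] at s₁
  have := Spaced.glue (d := d) (A := translate v₁ (a (i + 6)) ++ translate v₁ (a (i + 7)) ++
      translate v₁ (a i) ++ translate v₁ (a (i + 1)) ++ translate v₁ (a (i + 2)))
    (B := (translate v₂ (a i)).reverse ++ (translate v₂ (a (i + 7))).reverse)
    (by simp; omega) (by simpa only [List.append_assoc] using s₁)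
    (by simpa only [List.append_assoc] using s₂)
  have := Spaced.glue (d := d) (A := (translate v₀ (a (i + 6))).reverse ++
      (translate v₀ (a (i + 5))).reverse ++ (translate v₀ (a (i + 4))).reverse)
    (B := (translate v₀ (a (i + 3))).reverse ++ (translate v₀ (a (i + 2))).reverse)
    (by simp; omega) (by simpa only [List.append_assoc] using s₀)
    (by simpa only [List.append_assoc, e₀] using this)
  simpa only [List.append_assoc] using this

theorem spaced_three_five (h₀ : v₁ = frameShift m n (i + 6) + v₀)
    (h₂ : v₁ = frameShift m n (i + 3) + v₂) :
    Spaced d R (translate v₀ (a (i + 7) ++ a i ++ a (i + 1)) ++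
      (translate v₁ (a (i + 3) ++ a (i + 4) ++ a (i + 5) ++ a (i + 6) ++ a (i + 7)).reverse ++
        translate v₂ (a (i + 1) ++ a (i + 2) ++ a (i + 3)))) := by
  have e₀ := T.exchange (i + 6) h₀
  have e₂ := T.exchange (i + 3) h₂
  have s₀ := (H 5 (i + 7)).translate htr v₀
  have s₁ := ((H 5 (i + 3)).translate htr v₁).reverse hsymm
  have s₂ := (H 5 (i + 7)).translate htr v₂
  have l₀ := T.length_pair (i + 6)
  have l₁ := T.length_pair (i + 3)
  simp only [arc, add_assoc, Fin.reduceAdd, add_zero, translate_append, List.append_nil,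
    List.reverse_append, translate_reverse] at *
  rw [← e₀] at s₀
  rw [← List.append_assoc, ← e₂] at s₂
  have := Spaced.glue (d := d) (A := (translate v₁ (a (i + 7))).reverse ++
      (translate v₁ (a (i + 6))).reverse ++ (translate v₁ (a (i + 5))).reverse)
    (B := (translate v₁ (a (i + 4))).reverse ++ (translate v₁ (a (i + 3))).reverse)
    (by simp; omega) (by simpa only [List.append_assoc] using s₁) s₂
  have := Spaced.glue (d := d) (A := translate v₀ (a (i + 7)) ++ translate v₀ (a i) ++
      translate v₀ (a (i + 1)))
    (B := (translate v₁ (a (i + 7))).reverse ++ (translate v₁ (a (i + 6))).reverse)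
    (by simp; omega) (by simpa only [List.append_assoc] using s₀)
    (by simpa only [List.append_assoc] using this)
  simpa only [List.append_assoc] using this

end spaced

section tight
variable (T : IsTrack m n x y a) (H : ∀ k ≤ 7, ∀ i, Tight Step (arc a i k)) (i : Dir)
  {v₀ v₁ : Square}
include T H

/-- Adjacent pairs within a copied arc are settled by `exchange` and the old tightness. The
hypothesis `h` excludes the pairs that no copied arc contains. -/
theorem tight_one_three (h₀ : v₁ = frameShift m n (i + 5) + v₀)
    (h : ∀ u ∈ translate v₀ (a i), ∀ v ∈ translate v₁ (a (i + 4)), ¬ Step u v) :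
    Tight Step (translate v₀ (a i) ++
      translate v₁ (a (i + 4) ++ a (i + 5) ++ a (i + 6)).reverse) := by
  have e₀ := T.exchange (i + 5) h₀
  have s₀ := (H 3 (by omega) i).translate v₀
  have s₁ := ((H 3 (by omega) (i + 4)).translate v₁).reverse
  simp only [arc, add_assoc, Fin.reduceAdd, translate_append, List.append_nil,
    List.reverse_append, translate_reverse] at *
  rw [← e₀] at s₀
  have := Tight.glue (fun _ _ => Step.symm) s₀ s₁ (by simpa using h)
  simpa only [List.append_assoc] using this

theorem tight_three_one (h₀ : v₀ = frameShift m n (i + 3) + v₁)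
    (h : ∀ u ∈ translate v₀ (a (i + 5)), ∀ v ∈ translate v₁ (a (i + 1)), ¬ Step u v) :
    Tight Step (translate v₀ (a (i + 3) ++ a (i + 4) ++ a (i + 5)).reverse ++
      translate v₁ (a (i + 1))) := by
  have e₀ := T.exchange (i + 3) h₀
  have s₀ := ((H 3 (by omega) (i + 3)).translate v₀).reverse
  have s₁ := (H 3 (by omega) (i + 7)).translate v₁
  simp only [arc, add_assoc, Fin.reduceAdd, add_zero, translate_append, List.append_nil,
    List.reverse_append, translate_reverse] at *
  rw [← List.append_assoc, ← e₀] at s₁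
  have := Tight.glue (A := (translate v₀ (a (i + 5))).reverse)
    (B := (translate v₀ (a (i + 4))).reverse ++ (translate v₀ (a (i + 3))).reverse)
    (fun _ _ => Step.symm) (by simpa only [List.append_assoc] using s₀)
    (by simpa only [List.append_assoc] using s₁) (by simpa using h)
  simpa only [List.append_assoc] using this

theorem tight_five_three (h₀ : v₀ = frameShift m n (i + 2) + v₁)
    (h : ∀ u ∈ translate v₀ (a (i + 4) ++ a (i + 5) ++ a (i + 6)),
      ∀ v ∈ translate v₁ (a i ++ a (i + 1) ++ a (i + 2)), ¬ Step u v) :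
    Tight Step (translate v₀
      (a (i + 2) ++ a (i + 3) ++ a (i + 4) ++ a (i + 5) ++ a (i + 6)).reverse ++
      translate v₁ (a i ++ a (i + 1) ++ a (i + 2))) := by
  have e₀ := T.exchange (i + 2) h₀
  have s₀ := ((H 5 (by omega) (i + 2)).translate v₀).reverse
  have s₁ := (H 5 (by omega) (i + 6)).translate v₁
  simp only [arc, add_assoc, Fin.reduceAdd, add_zero, translate_append, List.append_nil,
    List.reverse_append, translate_reverse] at *
  rw [← List.append_assoc, ← e₀] at s₁
  have := Tight.glue (A := (translate v₀ (a (i + 6))).reverse ++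
      (translate v₀ (a (i + 5))).reverse ++ (translate v₀ (a (i + 4))).reverse)
    (B := (translate v₀ (a (i + 3))).reverse ++ (translate v₀ (a (i + 2))).reverse)
    (fun _ _ => Step.symm) (by simpa only [List.append_assoc] using s₀) s₁
    (fun u hu v hv => h u (by simp at hu ⊢; tauto) v (by simp at hv ⊢; tauto))
  simpa only [List.append_assoc] using this

theorem tight_three_five (h₀ : v₁ = frameShift m n (i + 6) + v₀)
    (h : ∀ u ∈ translate v₀ (a (i + 7) ++ a i ++ a (i + 1)),
      ∀ v ∈ translate v₁ (a (i + 3) ++ a (i + 4) ++ a (i + 5)), ¬ Step u v) :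
    Tight Step (translate v₀ (a (i + 7) ++ a i ++ a (i + 1)) ++
      translate v₁ (a (i + 3) ++ a (i + 4) ++ a (i + 5) ++ a (i + 6) ++ a (i + 7)).reverse) := by
  have e₀ := T.exchange (i + 6) h₀
  have s₀ := (H 5 (by omega) (i + 7)).translate v₀
  have s₁ := ((H 5 (by omega) (i + 3)).translate v₁).reverse
  simp only [arc, add_assoc, Fin.reduceAdd, add_zero, translate_append, List.append_nil,
    List.reverse_append, translate_reverse] at *
  rw [← e₀] at s₀
  have := Tight.glue (A := translate v₀ (a (i + 7)) ++ translate v₀ (a i) ++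
      translate v₀ (a (i + 1)))
    (B := (translate v₁ (a (i + 7))).reverse ++ (translate v₁ (a (i + 6))).reverse)
    (C := (translate v₁ (a (i + 5))).reverse ++ ((translate v₁ (a (i + 4))).reverse ++
      (translate v₁ (a (i + 3))).reverse))
    (fun _ _ => Step.symm) (by simpa only [List.append_assoc] using s₀)
    (by simpa only [List.append_assoc] using s₁)
    (fun u hu v hv => h u (by simp at hu ⊢; tauto) v (by simp at hv ⊢; tauto))
  simpa only [List.append_assoc] using this

end tight
end IsTrack
-- The lifting of a track is a track
/-- The lengths of the paths of the lifting of a track. -/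
def Lifting.lengths : Lifting → ℕ × ℕ → ℕ × ℕ
  | .f, (x, y) => (x + 2 * y, y)
  | .g, (x, y) => (x, 2 * x + y)
  | .h, (x, y) => (3 * x + 2 * y, 2 * x + y)

namespace IsTrack
variable {m n x y : ℕ} {a : Dir → List Square}

theorem lift_nodup (T : IsTrack m n x y a) (hmn : m < n) (t : Lifting) (i : Dir) :
    (t.path m n a i).Nodup := by
  have h1 := T.nodup i
  have h3 (j : Dir) := T.nodup_arc hmn (k := 3) (by omega) j
  have h5 := T.nodup_arc hmn (k := 5) (by omega) (i + 2)
  have hinj : Function.Injective (· + t.shift m n i) := add_left_injective _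
  have h33 := h3 (i + 3)
  have h37 := h3 (i + 7)
  simp only [arc, add_assoc, Fin.reduceAdd, add_zero, List.append_nil] at h33 h37 h5
  rcases Nat.mod_two_eq_zero_or_one i.val with hi | hi <;> cases t <;>
    simp only [Lifting.path, hi, List.append_assoc] <;> refine List.Nodup.map hinj ?_ <;>
    simpa only [List.nodup_reverse]

theorem lift_tight (T : IsTrack m n x y a) (hm : 0 < m) (hmn : m < n) (hodd : Odd (m + n))
    (t : Lifting) (i : Dir) : Tight Step (t.path m n a i ++ t.path m n a (i + 1)) := by
  have H : ∀ k ≤ 7, ∀ i, Tight Step (arc a i k) := fun k hk i => T.tight_arc hmn hodd hk i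
  have left (i j : Dir) (hj : j ∈ t.dirs i) (s : Square) (hs : s ∈ translate (t.shift m n i) (a j)) :
      s ∈ frameSection (t.target (m, n)).1 (t.target (m, n)).2 i := by
    rw [mem_translate] at hs
    have := (frameSection_add_shift t hm hmn (T.mem _ _ hs)).2 hj
    rwa [sub_add_cancel] at this
  have nl (u v : Square) (j k : Dir) (hu : u ∈ translate (t.shift m n i) (a j))
      (hv : v ∈ translate (t.shift m n (i + 1)) (a k)) (hk : k ∈ t.dirs (i + 1))
      (ht : t = .g ∧ i.val % 2 = 1 ∧ j = i + 5 ∨ t = .f ∧ i.val % 2 = 0 ∧ j = i + 5 ∨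
        t = .h ∧ i.val % 2 = 0 ∧ (j = i + 4 ∨ j = i + 5 ∨ j = i + 6)) : ¬ Step u v := by
    have := t.not_adj_left hmn ht (T.mem _ _ (mem_translate.1 hu)) (left _ k hk v hv)
    rwa [sub_add_cancel] at this
  have nr (u v : Square) (j k : Dir) (hu : u ∈ translate (t.shift m n i) (a k))
      (hv : v ∈ translate (t.shift m n (i + 1)) (a j)) (hk : k ∈ t.dirs i)
      (ht : t = .g ∧ i.val % 2 = 0 ∧ j = i + 4 ∨ t = .f ∧ i.val % 2 = 1 ∧ j = i + 4 ∨
        t = .h ∧ i.val % 2 = 1 ∧ (j = i + 3 ∨ j = i + 4 ∨ j = i + 5)) : ¬ Step u v := by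
    have := t.not_adj_right hmn ht (left _ k hk u hu) (T.mem _ _ (mem_translate.1 hv))
    rwa [sub_add_cancel] at this
  rcases Nat.mod_two_eq_zero_or_one i.val with hi | hi
  · have hi1 := succ_mod_two_of_even hi
    cases t
    · rw [path_f_even hi, path_f_odd hi1]
      exact tight_three_one T H i (Lifting.f_shift_even hi) fun u hu v hv =>
        nl u v _ _ hu hv (by simp [Lifting.dirs, hi1]) (by simp [hi])
    · rw [path_g_even hi, path_g_odd hi1]
      have := tight_one_three T H i (Lifting.g_shift_even hi) fun u hu v hv =>
        nr u v _ _ hu hv (by simp [Lifting.dirs, hi]) (by simp [hi])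
      simpa only [add_assoc, Fin.reduceAdd] using this
    · rw [path_h_even hi, path_h_odd hi1]
      have := tight_five_three T H i (Lifting.h_shift_even hi) fun u hu v hv => by
        simp only [translate_append, List.mem_append, or_assoc] at hu hv
        obtain ⟨j, hj, hu⟩ : ∃ j, (j = i + 4 ∨ j = i + 5 ∨ j = i + 6) ∧
            u ∈ translate (Lifting.h.shift m n i) (a j) := by
          rcases hu with hu | hu | hu <;> exact ⟨_, by simp, hu⟩
        rcases hv with hv | hv | hv <;>
          exact nl u v _ _ hu hv (by simp [Lifting.dirs, hi1, add_assoc]) (by simp [hi, hj])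
      simpa only [add_assoc, Fin.reduceAdd, add_zero] using this
  · have hi1 := succ_mod_two_of_odd hi
    cases t
    · rw [path_f_odd hi, path_f_even hi1]
      have := tight_one_three T H i (Lifting.f_shift_odd hi) fun u hu v hv =>
        nr u v _ _ hu hv (by simp [Lifting.dirs, hi]) (by simp [hi])
      simpa only [add_assoc, Fin.reduceAdd] using this
    · rw [path_g_odd hi, path_g_even hi1]
      exact tight_three_one T H i (Lifting.g_shift_odd hi) fun u hu v hv =>
        nl u v _ _ hu hv (by simp [Lifting.dirs, hi1]) (by simp [hi])
    · rw [path_h_odd hi, path_h_even hi1]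
      have := tight_three_five T H i (Lifting.h_shift_odd hi) fun u hu v hv => by
        simp only [translate_append, List.mem_append, or_assoc] at hu hv
        obtain ⟨j, hj, hv⟩ : ∃ j, (j = i + 3 ∨ j = i + 4 ∨ j = i + 5) ∧
            v ∈ translate (Lifting.h.shift m n (i + 1)) (a j) := by
          rcases hv with hv | hv | hv <;> exact ⟨_, by simp, hv⟩
        rcases hu with hu | hu | hu <;>
          exact nr u v _ _ hu hv (by simp [Lifting.dirs, hi]) (by simp [hi, hj])
      simpa only [add_assoc, Fin.reduceAdd, add_zero] using this

theorem lift (T : IsTrack m n x y a) (hm : 0 < m) (hmn : m < n) (hodd : Odd (m + n))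
    (t : Lifting) : IsTrack (t.target (m, n)).1 (t.target (m, n)).2 (t.lengths (x, y)).1
      (t.lengths (x, y)).2 (t.path m n a) where
  pos_x := by have := T.pos_x; cases t <;> simp only [Lifting.lengths] <;> omega
  pos_y := by have := T.pos_y; cases t <;> simp only [Lifting.lengths] <;> omega
  length_even i hi := by
    have h1 := T.length_pair (i + 3)
    have h2 := T.length_pair (i + 2)
    have h3 := T.length_pair (i + 5)
    have h4 := T.length_odd (i + 5) (by clear * - hi; revert i; decide)
    have h5 := T.length_even (i + 4) (by clear * - hi; revert i; decide)
    simp only [add_assoc, Fin.reduceAdd] at h1 h2 h3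
    cases t
    · simp [path_f_even hi, Lifting.lengths]; omega
    · simp [path_g_even hi, Lifting.lengths, T.length_even i hi]
    · simp [path_h_even hi, Lifting.lengths]; omega
  length_odd i hi := by
    have h1 := T.length_pair (i + 3)
    have h2 := T.length_pair (i + 7)
    have h4 := T.length_even (i + 5) (by clear * - hi; revert i; decide)
    have h5 := T.length_even (i + 1) (by clear * - hi; revert i; decide)
    simp only [add_assoc, Fin.reduceAdd, add_zero] at h1 h2
    cases t
    · simp [path_f_odd hi, Lifting.lengths, T.length_odd i hi]
    · simp [path_g_odd hi, Lifting.lengths]; omega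
    · simp [path_h_odd hi, Lifting.lengths]; omega
  mem i s hs := by
    obtain ⟨j, hj, hs⟩ := mem_path.1 hs
    have := (frameSection_add_shift t hm hmn (T.mem _ _ hs)).2 hj
    rwa [sub_add_cancel] at this
  nodup i := T.lift_nodup hmn t i
  shift i := T.shift_lift hmn t i
  tight i := T.lift_tight hm hmn hodd t i

/-- Paths grow under lifting but the distance `d` stays fixed. This is the inductive step both for
side steps and for knight moves. -/
theorem spaced_lift {d : ℕ} {R : Square → Square → Prop} (T : IsTrack m n x y a)
    (hsymm : ∀ u v, R u v → R v u) (htr : ∀ w u v, R u v → R (u + w) (v + w)) (hd : d ≤ x + y)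
    (H₃ : ∀ i, Spaced d R (arc a i 3)) (t : Lifting) (i : Dir) :
    Spaced d R (arc (t.path m n a) i 3) := by
  have H := T.spaced_arc hd H₃
  simp only [arc, add_assoc, Fin.reduceAdd, List.append_nil]
  rcases Nat.mod_two_eq_zero_or_one i.val with hi | hi
  · have hi1 := succ_mod_two_of_even hi
    have hi2 := succ_mod_two_of_odd hi1
    simp only [add_assoc, Fin.reduceAdd] at hi2
    cases t
    · rw [path_f_even hi, path_f_odd hi1, path_f_even hi2]
      have := T.spaced_three_one hsymm htr hd H i
        (v₂ := Lifting.f.shift m n (i + 2)) (Lifting.f_shift_even hi)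
        (by simpa only [add_assoc, Fin.reduceAdd] using Lifting.f_shift_odd hi1)
      simpa only [add_assoc, Fin.reduceAdd, add_zero] using this
    · rw [path_g_even hi, path_g_odd hi1, path_g_even hi2]
      have := T.spaced_one_three hsymm htr hd H i
        (v₂ := Lifting.g.shift m n (i + 2)) (Lifting.g_shift_even hi)
        (by simpa only [add_assoc, Fin.reduceAdd] using Lifting.g_shift_odd hi1)
      simpa only [add_assoc, Fin.reduceAdd, add_zero] using this
    · rw [path_h_even hi, path_h_odd hi1, path_h_even hi2]
      have := T.spaced_five_three hsymm htr hd H i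
        (v₂ := Lifting.h.shift m n (i + 2)) (Lifting.h_shift_even hi)
        (by simpa only [add_assoc, Fin.reduceAdd] using Lifting.h_shift_odd hi1)
      simpa only [add_assoc, Fin.reduceAdd, add_zero] using this
  · have hi1 := succ_mod_two_of_odd hi
    have hi2 := succ_mod_two_of_even hi1
    simp only [add_assoc, Fin.reduceAdd] at hi2
    cases t
    · rw [path_f_odd hi, path_f_even hi1, path_f_odd hi2]
      have := T.spaced_one_three hsymm htr hd H i
        (v₂ := Lifting.f.shift m n (i + 2)) (Lifting.f_shift_odd hi)
        (by simpa only [add_assoc, Fin.reduceAdd] using Lifting.f_shift_even hi1)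
      simpa only [add_assoc, Fin.reduceAdd, add_zero] using this
    · rw [path_g_odd hi, path_g_even hi1, path_g_odd hi2]
      have := T.spaced_three_one hsymm htr hd H i
        (v₂ := Lifting.g.shift m n (i + 2)) (Lifting.g_shift_odd hi)
        (by simpa only [add_assoc, Fin.reduceAdd] using Lifting.g_shift_even hi1)
      simpa only [add_assoc, Fin.reduceAdd, add_zero] using this
    · rw [path_h_odd hi, path_h_even hi1, path_h_odd hi2]
      have := T.spaced_three_five hsymm htr hd H i
        (v₂ := Lifting.h.shift m n (i + 2)) (Lifting.h_shift_odd hi)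
        (by simpa only [add_assoc, Fin.reduceAdd] using Lifting.h_shift_even hi1)
      simpa only [add_assoc, Fin.reduceAdd, add_zero] using this

end IsTrack
-- The leaper cycle over the squares of a track
theorem IsMove.neg {p q : ℕ} {v : Square} (h : IsMove p q v) : IsMove p q (-v) := by
  simpa [IsMove] using h

theorem isMove_frameShift (m n : ℕ) (i : Dir) : IsMove m n (frameShift m n i) := by
  fin_cases i <;> simp [IsMove, frameShift]

theorem frameShift_ne {m n : ℕ} (hm : 0 < m) (hmn : m < n) (i : Dir) :
    frameShift m n i ≠ frameShift m n (i + 7) := by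
  fin_cases i <;> simp [frameShift] <;> omega

/-- Any two squares of `S` are connected by moves of the `(p, q)`-leaper within `S`. -/
def MoveConnected (p q : ℕ) (S : Set Square) : Prop :=
  ∀ P : Square → Prop, (∀ u ∈ S, ∀ v ∈ S, IsMove p q (v - u) → P u → P v) →
    ∀ u ∈ S, ∀ v ∈ S, P u → P v

/-- The squares of a system of paths. -/
def trackSet (a : Dir → List Square) : Set Square := {s | ∃ i, s ∈ a i}

/-- The middle one of the sections to which a lifting translates squares of section `j`. -/
def Lifting.center (t : Lifting) (j : Dir) : Dir :=
  match t, j.val % 2 with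
  | .f, 0 => j + 4
  | .f, _ => j
  | .g, 0 => j
  | .g, _ => j + 4
  | .h, 0 => j + 4
  | .h, _ => j

theorem Lifting.mem_dirs_center (t : Lifting) (j : Dir) : j ∈ t.dirs (t.center j) := by
  cases t <;> revert j <;> decide

/-- The sections that receive copies of section `j` are reached from the middle one by at most two
steps of `5`, or at most two of `3`, through such sections only. Each step joins two copies of a
square by a move. -/
theorem Lifting.mem_dirs (t : Lifting) (i j : Dir) (h : j ∈ t.dirs i) :
    i = t.center j ∨ i = t.center j + 5 ∨ i = t.center j + 3 ∨
      (i = t.center j + 5 + 5 ∧ j ∈ t.dirs (t.center j + 5)) ∨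
      (i = t.center j + 3 + 3 ∧ j ∈ t.dirs (t.center j + 3)) := by
  cases t <;> revert i j <;> decide

/-- A section whose squares are translated so that the moves `frameShift m n s` are preserved. -/
def Lifting.moveDir (t : Lifting) (s : Dir) : Dir :=
  match t, s.val % 2 with
  | .f, 0 => s + 4
  | .f, _ => s + 5
  | .g, 0 => s + 5
  | .g, _ => s + 4
  | .h, 0 => s + 6
  | .h, _ => s + 3

theorem Lifting.mem_dirs_moveDir (t : Lifting) (s : Dir) :
    s ∈ t.dirs (t.moveDir s) ∧ s + 1 ∈ t.dirs (t.moveDir s) ∧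
      s + 4 ∈ t.dirs (t.moveDir s + 4) ∧ s + 5 ∈ t.dirs (t.moveDir s + 4) := by
  cases t <;> revert s <;> decide

/-- A move of the smaller leaper survives as a move of the larger one between suitable copies of its
ends, those in two opposite sections. -/
theorem Lifting.isMove_moveDir (t : Lifting) {m n : ℕ} (hmn : m < n) (s : Dir) :
    IsMove (t.target (m, n)).1 (t.target (m, n)).2
      (frameShift m n s + t.shift m n (t.moveDir s + 4) - t.shift m n (t.moveDir s)) := by
  cases t <;> fin_cases s <;>
    simp [IsMove, Lifting.target, Lifting.moveDir, Lifting.shift, frameShift, dirVec] <;> omega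

namespace IsTrack
variable {m n x y : ℕ} {a : Dir → List Square}

theorem add_frameShift_mem (T : IsTrack m n x y a) {s : Dir} {c : Square}
    (hc : c ∈ a s ∨ c ∈ a (s + 1)) :
    c + frameShift m n s ∈ a (s + 4) ∨ c + frameShift m n s ∈ a (s + 5) := by
  have : c + frameShift m n s ∈ translate (frameShift m n s) (a s ++ a (s + 1)) := by
    rw [mem_translate, add_sub_cancel_right]
    exact List.mem_append.2 hc
  rw [T.shift] at this
  simpa [or_comm] using this

theorem lift_trackSet (T : IsTrack m n x y a) (hm : 0 < m) (hmn : m < n) (t : Lifting) :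
    t.lift m n (trackSet a) = trackSet (t.path m n a) := by
  ext b
  simp only [Lifting.lift, trackSet, Set.mem_ofPred_eq, mem_path]
  refine exists_congr fun i => ⟨?_, ?_⟩
  · rintro ⟨hb, j, hj⟩
    refine ⟨j, ?_, hj⟩
    rw [← frameSection_add_shift t hm hmn (T.mem _ _ hj), sub_add_cancel]
    exact hb
  · rintro ⟨j, hj, hb⟩
    have := (frameSection_add_shift t hm hmn (T.mem _ _ hb)).2 hj
    rw [sub_add_cancel] at this
    exact ⟨this, j, hb⟩

/-- All copies of one square are joined to each other, and each small move lifts to a move between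
some copies of its ends. So a predicate preserved by large moves descends to one preserved by small
moves. -/
theorem moveConnected_lift (T : IsTrack m n x y a) (hm : 0 < m) (hmn : m < n) (t : Lifting)
    (h : MoveConnected m n (trackSet a)) :
    MoveConnected (t.target (m, n)).1 (t.target (m, n)).2 (trackSet (t.path m n a)) := by
  intro P hP
  have hmem {i j : Dir} {c : Square} (hj : j ∈ t.dirs i) (hc : c ∈ a j) :
      c + t.shift m n i ∈ trackSet (t.path m n a) :=
    ⟨i, mem_path.2 ⟨j, hj, by rwa [add_sub_cancel_right]⟩⟩
  have five {i j : Dir} {c : Square} (hj : j ∈ t.dirs i) (hj' : j ∈ t.dirs (i + 5)) (hc : c ∈ a j) :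
      P (c + t.shift m n i) ↔ P (c + t.shift m n (i + 5)) := by
    have e : c + t.shift m n (i + 5) - (c + t.shift m n i) =
        frameShift (t.target (m, n)).1 (t.target (m, n)).2 i := by
      rw [← t.shift_add_frameShift hmn]; abel
    have hmove := isMove_frameShift (t.target (m, n)).1 (t.target (m, n)).2 i
    rw [← e] at hmove
    exact ⟨hP _ (hmem hj hc) _ (hmem hj' hc) hmove,
      hP _ (hmem hj' hc) _ (hmem hj hc) (by simpa using hmove.neg)⟩
  have three {i j : Dir} {c : Square} (hj : j ∈ t.dirs i) (hj' : j ∈ t.dirs (i + 3))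
      (hc : c ∈ a j) : P (c + t.shift m n i) ↔ P (c + t.shift m n (i + 3)) := by
    have e : i + 3 + 5 = i := by simp [add_assoc]
    have := five hj' (by rwa [e]) hc
    rw [e] at this
    exact this.symm
  have center {i j : Dir} {c : Square} (hj : j ∈ t.dirs i) (hc : c ∈ a j) :
      P (c + t.shift m n i) ↔ P (c + t.shift m n (t.center j)) := by
    have h0 := t.mem_dirs_center j
    rcases t.mem_dirs i j hj with rfl | rfl | rfl | ⟨rfl, h1⟩ | ⟨rfl, h1⟩
    · rfl
    · exact (five h0 hj hc).symm
    · exact (three h0 hj hc).symm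
    · exact ((five h0 h1 hc).trans (five h1 hj hc)).symm
    · exact ((three h0 h1 hc).trans (three h1 hj hc)).symm
  -- The descended predicate must depend on the square alone, hence the quantifier over sections; as
  -- these are disjoint, only one of them counts.
  have key {j : Dir} {c : Square} (hc : c ∈ a j) (Q : Square → Prop)
      (hQ : Q = fun c => ∀ j, c ∈ a j → P (c + t.shift m n (t.center j))) :
      Q c ↔ P (c + t.shift m n (t.center j)) := by
    subst hQ
    refine ⟨fun h => h j hc, fun h k hk => ?_⟩
    rwa [← eq_of_mem_frameSection hmn (T.mem _ _ hc) (T.mem _ _ hk)]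
  generalize hQ : (fun c => ∀ j, c ∈ a j → P (c + t.shift m n (t.center j))) = Q at key
  have key' {i j : Dir} {c : Square} (hj : j ∈ t.dirs i) (hc : c ∈ a j) :
      P (c + t.shift m n i) ↔ Q c := (center hj hc).trans (key hc Q rfl).symm
  have move {s : Dir} {c : Square} (hc : c ∈ a s ∨ c ∈ a (s + 1)) (h : Q c) :
      Q (c + frameShift m n s) := by
    obtain ⟨h0, h1, h4, h5⟩ := t.mem_dirs_moveDir s
    have hd := T.add_frameShift_mem hc
    have hmove := t.isMove_moveDir (m := m) hmn s
    obtain ⟨j, hj, hc⟩ : ∃ j ∈ t.dirs (t.moveDir s), c ∈ a j := by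
      rcases hc with hc | hc <;> exact ⟨_, by assumption, hc⟩
    obtain ⟨k, hk, hd⟩ : ∃ k ∈ t.dirs (t.moveDir s + 4), c + frameShift m n s ∈ a k := by
      rcases hd with hd | hd <;> exact ⟨_, by assumption, hd⟩
    rw [← key' hk hd]
    refine hP _ (hmem hj hc) _ (hmem hk hd) ?_ ((key' hj hc).2 h)
    convert hmove using 1
    abel
  have main := h Q (by
    rintro u ⟨j, hj⟩ v ⟨k, hk⟩ huv hu
    rcases move_sections hm hmn (T.mem _ _ hj) (T.mem _ _ hk) huv with rfl | rfl
    · exact move (.inl hj) hu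
    · exact move (s := j + 7) (.inr (by simpa [add_assoc] using hj)) hu)
  rintro u ⟨i, hu⟩ v ⟨k, hv⟩ huP
  obtain ⟨j, hj, hu⟩ := mem_path.1 hu
  obtain ⟨l, hl, hv⟩ := mem_path.1 hv
  have h1 := key' hj hu
  have h2 := key' hl hv
  rw [sub_add_cancel] at h1 h2
  exact h2.2 (main _ ⟨j, hu⟩ _ ⟨l, hv⟩ (h1.1 huP))

/-- Both candidate moves from a square stay in the set by the symmetry of the track, so the graph is
finite and 2-regular. Its components are then cycles, and connectedness leaves just one. -/
theorem isToured (T : IsTrack m n x y a) (hm : 0 < m) (hmn : m < n)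
    (h : MoveConnected m n (trackSet a)) : IsToured m n (trackSet a) := by
  classical
  set G := leaperGraphOn m n (trackSet a)
  have hadj (u v : trackSet a) : G.Adj u v ↔ IsMove m n (v.1 - u.1) := by
    refine ⟨fun h => h.2, fun h => ⟨?_, h⟩⟩
    rintro h'
    rw [Function.Embedding.subtype_apply, Function.Embedding.subtype_apply] at h'
    simp [h', IsMove] at h
    omega
  have hfin : (trackSet a).Finite := by
    have : trackSet a = ⋃ i, {s | s ∈ a i} := by ext; simp [trackSet]
    rw [this]
    exact Set.finite_iUnion fun i => List.finite_toSet _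
  have : Finite (trackSet a) := hfin
  have hnbr (u : trackSet a) : (G.neighborSet u).ncard = 2 := by
    obtain ⟨c, j, hj⟩ := u
    have h1 := T.add_frameShift_mem (.inl hj)
    have h2 := T.add_frameShift_mem (s := j + 7) (c := c)
      (.inr (by simpa [add_assoc] using hj))
    have e : G.neighborSet ⟨c, j, hj⟩ =
        {⟨c + frameShift m n j, h1.elim (⟨_, ·⟩) (⟨_, ·⟩)⟩,
          ⟨c + frameShift m n (j + 7), h2.elim (⟨_, ·⟩) (⟨_, ·⟩)⟩} := by
      ext ⟨d, k, hk⟩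
      simp only [SimpleGraph.mem_neighborSet, hadj, Set.mem_insert_iff, Set.mem_singleton_iff,
        Subtype.ext_iff]
      refine ⟨move_sections hm hmn (T.mem _ _ hj) (T.mem _ _ hk), ?_⟩
      rintro (rfl | rfl) <;> simpa using isMove_frameShift _ _ _
    rw [e, Set.ncard_pair]
    simpa using frameShift_ne hm hmn j
  have hcyc : G.IsCycles := fun v _ => hnbr v
  obtain ⟨c, hc⟩ := List.exists_mem_of_ne_nil _ (T.ne_nil 0)
  let v : trackSet a := ⟨c, 0, hc⟩
  have hconn (u : trackSet a) : G.Reachable v u := by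
    -- Connectedness is applied to the predicate of being reachable from `v`.
    have := h (fun s => ∃ hs : s ∈ trackSet a, G.Reachable v ⟨s, hs⟩)
      (fun s hs r hr hsr ⟨_, hvs⟩ => ⟨hr, hvs.trans
        ((hadj ⟨s, hs⟩ ⟨r, hr⟩).2 hsr).reachable⟩) v.1 v.2 u.1 u.2 ⟨v.2, .refl _⟩
    exact this.2
  obtain ⟨w, hw, hverts⟩ := hcyc.exists_cycle_toSubgraph_verts_eq_connectedComponentSupp
    (v := v) (c := G.connectedComponentMk v) rfl
    (Set.nonempty_of_ncard_ne_zero (by rw [hnbr]; decide))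
  refine ⟨v, w, hw, (hw.isPath_tail.isHamiltonian_of_mem fun u => ?_)⟩
  have hu : u ∈ w.support := by
    rw [← SimpleGraph.Walk.mem_verts_toSubgraph, hverts]
    exact SimpleGraph.ConnectedComponent.sound (hconn u).symm
  rw [SimpleGraph.Walk.support_tail_of_not_nil _ hw.not_nil]
  rcases (SimpleGraph.Walk.mem_support_iff w).1 hu with rfl | hu
  · exact SimpleGraph.Walk.end_mem_tail_support hw.not_nil
  · exact hu

end IsTrack
-- Hamiltonian cycles as periodic sequences
section walks
variable {V : Type*} {G : SimpleGraph V}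

theorem exists_walk_of_adj (f : ℕ → V) (N : ℕ) (h : ∀ i < N, G.Adj (f i) (f (i + 1))) :
    ∃ w : G.Walk (f 0) (f N), w.length = N ∧ ∀ i ≤ N, w.getVert i = f i := by
  induction N generalizing f with
  | zero => exact ⟨.nil, rfl, by simp⟩
  | succ N ih =>
    obtain ⟨w, hw, hf⟩ := ih (fun i => f (i + 1)) fun i hi => h (i + 1) (by omega)
    refine ⟨.cons (h 0 (by omega)) w, by simp [hw], fun i hi => ?_⟩
    cases i with
    | zero => simp
    | succ i => rw [SimpleGraph.Walk.getVert_cons_succ, hf i (by omega)]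

/-- The values at `1`, …, `N` are distinct and exhaust the vertices, so the tail of the walk is a
Hamiltonian path. The bound `3 ≤ N` excludes going back and forth along one edge. -/
theorem exists_isHamiltonianCycle [DecidableEq V] {f : ℕ → V} {N : ℕ} {a : V} (hN : 3 ≤ N)
    (h0 : f 0 = a) (hadj : ∀ i, G.Adj (f i) (f (i + 1)))
    (hf : ∀ i j, f i = f j ↔ i ≡ j [MOD N]) (hsurj : ∀ v, ∃ i, f i = v) :
    ∃ w : G.Walk a a, w.IsHamiltonianCycle ∧ w.length = N ∧ ∀ i ≤ N, w.getVert i = f i := by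
  subst h0
  have hper : f N = f 0 := (hf _ _).2 (by simp [Nat.ModEq])
  obtain ⟨w', hw', hget'⟩ := exists_walk_of_adj f N fun i _ => hadj i
  obtain ⟨w, hw, hget⟩ : ∃ w : G.Walk (f 0) (f 0), w.length = N ∧ ∀ i ≤ N, w.getVert i = f i :=
    ⟨w'.copy rfl hper, by simpa, by simpa⟩
  have hnil : ¬ w.Nil := by rw [← SimpleGraph.Walk.length_eq_zero_iff]; omega
  have htail : w.tail.length + 1 = N := by rw [SimpleGraph.Walk.length_tail_add_one hnil, hw]
  have hpath : w.tail.IsPath := by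
    rw [← SimpleGraph.Walk.IsPath.getVert_injOn_iff]
    intro i hi j hj hij
    simp only [Set.mem_ofPred_eq] at hi hj
    rw [SimpleGraph.Walk.getVert_tail, SimpleGraph.Walk.getVert_tail, hget _ (by omega),
      hget _ (by omega), hf] at hij
    have := Nat.ModEq.add_right_cancel' 1 hij
    rwa [Nat.ModEq, Nat.mod_eq_of_lt (by omega), Nat.mod_eq_of_lt (by omega)] at this
  have hcyc : w.IsCycle := SimpleGraph.Walk.isCycle_iff_isPath_tail_and_le_length.2
    ⟨hpath, by omega⟩
  refine ⟨w, ⟨hcyc, hpath.isHamiltonian_of_mem fun v => ?_⟩, hw, hget⟩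
  obtain ⟨i, rfl⟩ := hsurj v
  have e : f i = w.getVert (i % N) := by
    rw [hget _ (Nat.mod_lt _ (by omega)).le, hf]
    exact (Nat.mod_modEq _ _).symm
  rw [e, SimpleGraph.Walk.support_tail_of_not_nil _ hnil]
  rcases Nat.eq_zero_or_pos (i % N) with h | h
  · rw [h, SimpleGraph.Walk.getVert_zero]
    exact SimpleGraph.Walk.end_mem_tail_support hnil
  · exact SimpleGraph.Walk.getVert_mem_tail_support hnil h.ne'

theorem _root_.SimpleGraph.Walk.IsHamiltonianCycle.cyclic [DecidableEq V] {a : V}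
    {w : G.Walk a a} (hw : w.IsHamiltonianCycle) :
    (∀ i, G.Adj (w.getVert (i % w.length)) (w.getVert ((i + 1) % w.length))) ∧
    (∀ i j, w.getVert (i % w.length) = w.getVert (j % w.length) ↔ i ≡ j [MOD w.length]) ∧
    ∀ v, ∃ i, w.getVert (i % w.length) = v := by
  have h3 := hw.isCycle.three_le_length
  have hlt (i : ℕ) : i % w.length < w.length := Nat.mod_lt _ (by omega)
  refine ⟨fun i => ?_, fun i j => ⟨fun h => ?_, fun h => by rw [h]⟩, fun v => ?_⟩
  · have := w.adj_getVert_succ (hlt i)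
    rw [Nat.add_mod, Nat.mod_eq_of_lt (show 1 < w.length by omega)]
    rcases Nat.lt_or_ge (i % w.length + 1) w.length with h | h
    · rwa [Nat.mod_eq_of_lt h]
    · have e : i % w.length + 1 = w.length := le_antisymm (hlt i) h
      rw [e, w.getVert_length] at this
      rwa [e, Nat.mod_self, w.getVert_zero]
  · have h1 := hlt i
    have h2 := hlt j
    exact hw.isCycle.getVert_injOn' (by simp only [Set.mem_ofPred_eq]; omega)
      (by simp only [Set.mem_ofPred_eq]; omega) h
  · obtain ⟨i, rfl, hi⟩ := SimpleGraph.Walk.mem_support_iff_exists_getVert.1 (hw.mem_support v)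
    rcases hi.eq_or_lt with rfl | hi
    · exact ⟨0, by simp⟩
    · exact ⟨i, by rw [Nat.mod_eq_of_lt hi]⟩

end walks

/-- The element with index `t` of the list, the indices being taken modulo its length. -/
def cyclicGet (l : List Square) (t : ℕ) : Square := l.getD (t % l.length) 0

section cyclicGet
variable {l : List Square}

/-- The default value in `cyclicGet` never occurs for a nonempty list. -/
theorem getElem?_mod_length (hl : l ≠ []) (t : ℕ) :
    l[t % l.length]? = some (cyclicGet l t) := by
  have := Nat.mod_lt t (List.length_pos_of_ne_nil hl)
  simp [cyclicGet, List.getD, this]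

theorem getElem?_append_self {t : ℕ} (ht : t < l.length + l.length) :
    (l ++ l)[t]? = some (cyclicGet l t) := by
  have hl : l ≠ [] := by rintro rfl; simp at ht
  rw [← getElem?_mod_length hl]
  by_cases h : t < l.length
  · rw [List.getElem?_append_left h, Nat.mod_eq_of_lt h]
  · rw [List.getElem?_append_right (by omega), Nat.mod_eq_sub_mod (by omega),
      Nat.mod_eq_of_lt (by omega)]

theorem cyclicGet_mem (hl : l ≠ []) (t : ℕ) : cyclicGet l t ∈ l :=
  List.mem_of_getElem? (getElem?_mod_length hl t)

theorem exists_cyclicGet {s : Square} (hs : s ∈ l) : ∃ t, cyclicGet l t = s := by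
  obtain ⟨t, ht, rfl⟩ := List.getElem_of_mem hs
  have := getElem?_append_self (l := l) (t := t) (by omega)
  rw [List.getElem?_append_left ht, List.getElem?_eq_getElem ht] at this
  exact ⟨t, (Option.some_injective _ this).symm⟩

theorem cyclicGet_eq_iff (hl : l ≠ []) (hn : l.Nodup) {s t : ℕ} :
    cyclicGet l s = cyclicGet l t ↔ s ≡ t [MOD l.length] := by
  have hs := Nat.mod_lt s (List.length_pos_of_ne_nil hl)
  refine ⟨fun h => ?_, fun h => by rw [cyclicGet, cyclicGet, h]⟩
  refine (List.getElem?_inj hs hn).1 ?_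
  rw [getElem?_mod_length hl, getElem?_mod_length hl, h]

/-- The doubled list contains all pairs at cyclic distance `d`, including those that wrap around. -/
theorem Spaced.cyclicGet {d : ℕ} {R : Square → Square → Prop} (h : Spaced d R (l ++ l))
    (hd : d ≤ l.length) (hl : l ≠ []) (t : ℕ) : R (cyclicGet l t) (cyclicGet l (t + d)) := by
  have ht := Nat.mod_lt t (List.length_pos_of_ne_nil hl)
  have e1 : Leaper.cyclicGet l t = Leaper.cyclicGet l (t % l.length) := by
    rw [Leaper.cyclicGet, Leaper.cyclicGet, Nat.mod_mod]
  have e2 : Leaper.cyclicGet l (t + d) = Leaper.cyclicGet l (t % l.length + d) := by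
    rw [Leaper.cyclicGet, Leaper.cyclicGet, Nat.mod_add_mod]
  rw [e1, e2]
  exact h _ _ _ (getElem?_append_self (by omega)) (getElem?_append_self (by omega))

end cyclicGet

/-! ### The closed path of a track and its knight tour -/

namespace IsTrack
variable {m n x y : ℕ} {a : Dir → List Square}

theorem length_arc_eight (T : IsTrack m n x y a) : (arc a 0 8).length = 4 * (x + y) := by
  have h0 := T.length_pair 0
  have h2 := T.length_pair 2
  have h4 := T.length_pair 4
  have h6 := T.length_pair 6
  simp only [Fin.reduceAdd, zero_add] at h0 h2 h4 h6
  simp only [arc, Fin.reduceAdd, zero_add, List.length_append, List.length_nil]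
  omega

theorem mem_trackSet {s : Square} : s ∈ trackSet a ↔ s ∈ arc a 0 8 := by
  rw [mem_arc]
  constructor
  · rintro ⟨i, hi⟩
    exact ⟨i.val, i.isLt, by simpa using hi⟩
  · rintro ⟨l, -, hl⟩
    exact ⟨_, hl⟩

theorem arc_eight_ne_nil (T : IsTrack m n x y a) : arc a 0 8 ≠ [] := by
  have := T.ne_nil 0
  simp [arc, this]

theorem arc_sixteen : arc a 0 16 = arc a 0 8 ++ arc a 0 8 := by
  rw [arc_add a 0 8 8]
  rfl

theorem exists_consec (T : IsTrack m n x y a) (hmn : m < n) (hodd : Odd (m + n)) {u v : Square}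
    (hu : u ∈ trackSet a) (hv : v ∈ trackSet a) (h : Step u v) :
    ∃ t, (u = cyclicGet (arc a 0 8) t ∧ v = cyclicGet (arc a 0 8) (t + 1)) ∨
      (v = cyclicGet (arc a 0 8) t ∧ u = cyclicGet (arc a 0 8) (t + 1)) := by
  have key (u v : Square) (i : Dir) (h : Consec (a i ++ a (i + 1)) u v) :
      ∃ t, u = cyclicGet (arc a 0 8) t ∧ v = cyclicGet (arc a 0 8) (t + 1) := by
    have h : Consec (arc a 0 16) u v := by
      -- Two rounds are used so that `a 7 ++ a 0` is contiguous as well.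
      have e : i.val + (2 + (14 - i.val)) = 16 := by omega
      rw [← e, arc_add, arc_add]
      refine .append_left (.append_right ?_)
      simpa [arc] using h
    rw [arc_sixteen] at h
    obtain ⟨t, ht, ht'⟩ := h
    have hlt := (List.getElem?_eq_some_iff.1 ht).1
    have hlt' := (List.getElem?_eq_some_iff.1 ht').1
    rw [List.length_append] at hlt hlt'
    rw [getElem?_append_self hlt] at ht
    rw [getElem?_append_self hlt'] at ht'
    exact ⟨t, (Option.some_injective _ ht).symm, (Option.some_injective _ ht').symm⟩
  obtain ⟨i, hu⟩ := hu
  obtain ⟨j, hv⟩ := hv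
  have : Consec (a i ++ a (i + 1)) u v ∨ Consec (a i ++ a (i + 1)) v u ∨
      Consec (a j ++ a (j + 1)) u v ∨ Consec (a j ++ a (j + 1)) v u := by
    rcases adjacent_sections hmn hodd (T.mem _ _ hu) (T.mem _ _ hv) h with rfl | rfl | rfl
    · exact (T.tight j u (by simp [hu]) v (by simp [hv]) h).elim .inl (.inr ∘ .inl)
    · exact (T.tight i u (by simp [hu]) v (by simp [hv]) h).elim .inl (.inr ∘ .inl)
    · have e : i + 7 + 1 = i := by simp [add_assoc]
      exact .inr (.inr (T.tight (i + 7) u (by simp [e, hu]) v (by simp [hv]) h))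
  rcases this with h | h | h | h
  · exact (key _ _ _ h).imp fun _ => .inl
  · exact (key _ _ _ h).imp fun _ => .inr
  · exact (key _ _ _ h).imp fun _ => .inl
  · exact (key _ _ _ h).imp fun _ => .inr

theorem exists_isProperTour (T : IsTrack m n x y a) (hmn : m < n) (hxy : 1 ≤ x + y)
    (hstep : ∀ i, Spaced 1 Step (arc a i 3)) :
    ∃ (s : trackSet a) (w : (leaperGraphOn 0 1 (trackSet a)).Walk s s), IsProperTour m n w := by
  have hl := T.arc_eight_ne_nil
  have hlen := T.length_arc_eight
  have hn := T.nodup_arc hmn (k := 8) le_rfl 0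
  let f : ℕ → trackSet a := fun t => ⟨cyclicGet (arc a 0 8) t, mem_trackSet.2 (cyclicGet_mem hl t)⟩
  obtain ⟨w, hw, hwl, hget⟩ := exists_isHamiltonianCycle (G := leaperGraphOn 0 1 (trackSet a))
    (f := f) (N := (arc a 0 8).length) (by omega) rfl
    (fun i => by
      have h := T.spaced_arc hxy hstep 16 0
      rw [arc_sixteen] at h
      have h := h.cyclicGet (by omega) hl i
      refine ⟨?_, h⟩
      intro h'
      rw [Function.Embedding.subtype_apply, Function.Embedding.subtype_apply] at h'
      simp only [f] at h'
      rw [h'] at h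
      simp [Step, IsMove] at h)
    (fun i j => by rw [Subtype.ext_iff, cyclicGet_eq_iff hl hn])
    (fun v => by
      obtain ⟨t, ht⟩ := exists_cyclicGet (mem_trackSet.1 v.2)
      exact ⟨t, Subtype.ext ht⟩)
  refine ⟨f 0, w, hw, .inl ⟨a, ?_, fun i => ⟨T.ne_nil i, T.mem i⟩, T.shift⟩⟩
  have e : (List.ofFn a).flatten = arc a 0 8 := by
    simp [List.ofFn_succ, arc]
  rw [e]
  -- The tail of the support starts at `f 1`, hence the rotation by one.
  refine List.IsRotated.symm ⟨1, ?_⟩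
  refine List.ext_getElem (by simp [hwl]) fun k hk hk' => ?_
  rw [List.length_map, List.length_tail, SimpleGraph.Walk.length_support, hwl] at hk'
  rw [List.getElem_rotate, List.getElem_map, List.getElem_tail,
    SimpleGraph.Walk.support_getElem_eq_getVert, hget _ (by omega)]
  have := getElem?_mod_length hl (k + 1)
  exact Option.some_injective _ ((List.getElem?_eq_getElem _).symm.trans this)

/-- By `exists_consec` every side step is a step along the closed path. A walk that never turns back
keeps its direction, so three steps advance three places forwards or backwards. -/
theorem isMove_of_step (T : IsTrack m n x y a) (hmn : m < n) (hodd : Odd (m + n))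
    (hxy : 2 ≤ x + y) (h : Spaced 3 (fun u v => IsMove 1 2 (v - u)) (arc a 0 16)) {f : ℕ → Square}
    (hf : ∀ i, f i ∈ trackSet a) (hstep : ∀ i, Step (f i) (f (i + 1)))
    (hne : ∀ i, f i ≠ f (i + 2)) (i : ℕ) : IsMove 1 2 (f (i + 3) - f i) := by
  have hl := T.arc_eight_ne_nil
  have hlen := T.length_arc_eight
  have hn := T.nodup_arc hmn (k := 8) le_rfl 0
  rw [arc_sixteen] at h
  have h := h.cyclicGet (by omega) hl
  have hex (i : ℕ) := T.exists_consec hmn hodd (hf i) (hf (i + 1)) (hstep i)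
  generalize hD : arc a 0 8 = D at *
  have succ {s t : ℕ} (h : cyclicGet D s = cyclicGet D t) :
      cyclicGet D (s + 1) = cyclicGet D (t + 1) := by
    rw [cyclicGet_eq_iff hl hn] at h ⊢
    exact h.add_right 1
  have pred {s t : ℕ} (h : cyclicGet D (s + 1) = cyclicGet D (t + 1)) :
      cyclicGet D s = cyclicGet D t := by
    rw [cyclicGet_eq_iff hl hn] at h ⊢
    exact h.add_right_cancel' 1
  have forward {i t : ℕ} (h0 : f i = cyclicGet D t) (h1 : f (i + 1) = cyclicGet D (t + 1)) :
      f (i + 2) = cyclicGet D (t + 2) := by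
    obtain ⟨s, ⟨hs, hs'⟩ | ⟨hs, hs'⟩⟩ := hex (i + 1)
    · exact hs'.trans (succ (hs.symm.trans h1))
    · exact absurd (h0.trans ((pred (hs'.symm.trans h1)).symm.trans hs.symm)) (hne i)
  have backward {i t : ℕ} (h0 : f i = cyclicGet D (t + 1)) (h1 : f (i + 1) = cyclicGet D t) :
      ∃ s, f (i + 2) = cyclicGet D s ∧ f (i + 1) = cyclicGet D (s + 1) ∧
        f i = cyclicGet D (s + 2) := by
    obtain ⟨s, ⟨hs, hs'⟩ | ⟨hs, hs'⟩⟩ := hex (i + 1)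
    · exact absurd (h0.trans ((succ (h1.symm.trans hs)).trans hs'.symm)) (hne i)
    · exact ⟨s, hs, hs', h0.trans (succ (h1.symm.trans hs'))⟩
  obtain ⟨t, ⟨h0, h1⟩ | ⟨h1, h0⟩⟩ := hex i
  · have h3 := forward h1 (forward h0 h1)
    rw [h0, h3]
    exact h t
  · obtain ⟨s, h2, h1, h0⟩ := backward h0 h1
    obtain ⟨r, h3, h2', h1'⟩ := backward h1 h2
    have h0 : f i = cyclicGet D (r + 3) := h0.trans (succ (h1.symm.trans h1'))
    rw [h0, h3]
    simpa using (h r).neg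

/-- The number of squares, `4 (x + y)`, is prime to `3`, so multiplication by `3` permutes the
indices. -/
theorem exists_knight_tour (T : IsTrack m n x y a) (hmn : m < n) (hodd : Odd (m + n))
    (hxy : 2 ≤ x + y) (h : Spaced 3 (fun u v => IsMove 1 2 (v - u)) (arc a 0 16))
    (h3 : ¬ 3 ∣ x + y) {s : trackSet a} {w : (leaperGraphOn 0 1 (trackSet a)).Walk s s}
    (hw : w.IsHamiltonianCycle) :
    ∃ w' : (leaperGraphOn 1 2 (trackSet a)).Walk s s, w'.IsHamiltonianCycle ∧
      w'.length = w.length ∧ ∀ i ≤ w.length, w'.getVert i = w.getVert (3 * i % w.length) := by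
  obtain ⟨hadj, hinj, hsurj⟩ := hw.cyclic
  have hN3 := hw.isCycle.three_le_length
  have hN : w.length = 4 * (x + y) := by
    have e : trackSet a = ↑(arc a 0 8).toFinset := by
      ext s
      simpa using mem_trackSet
    have : Fintype (trackSet a) := e ▸ inferInstance
    rw [hw.length_eq, ← T.length_arc_eight, ← List.toFinset_card_of_nodup
      (T.nodup_arc hmn (k := 8) le_rfl 0), ← Nat.card_eq_fintype_card, Nat.card_coe_set_eq, e,
      Set.ncard_coe_finset]
  have hcop : Nat.Coprime w.length 3 := by
    rw [Nat.coprime_comm, Nat.Prime.coprime_iff_not_dvd Nat.prime_three]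
    omega
  have hmove := T.isMove_of_step hmn hodd hxy h (f := fun i => (w.getVert (i % w.length)).1)
    (fun i => (w.getVert _).2) (fun i => (hadj i).2) fun i hi => by
      -- Turning back would make the length divide `2`.
      have := (hinj _ _).1 (Subtype.ext hi)
      have := (Nat.modEq_iff_dvd' (by omega)).1 this
      rw [Nat.add_sub_cancel_left] at this
      exact absurd (Nat.le_of_dvd (by omega) this) (by omega)
  refine exists_isHamiltonianCycle (f := fun i => w.getVert (3 * i % w.length)) hN3 (by simp)
    (fun i => ⟨?_, hmove (3 * i)⟩) (fun i j => ?_) fun v => ?_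
  · intro e
    have := hmove (3 * i)
    simp only [Function.Embedding.subtype_apply] at e
    rw [show 3 * (i + 1) = 3 * i + 3 by ring] at e
    simp [e, IsMove] at this
  · rw [hinj]
    exact ⟨fun h => Nat.ModEq.cancel_left_of_coprime hcop h, fun h => h.mul_left 3⟩
  · obtain ⟨i, rfl⟩ := hsurj v
    obtain ⟨j, hj⟩ : ∃ j, 3 * j ≡ i [MOD w.length] := by
      obtain ⟨k, hk⟩ := Nat.exists_mul_mod_eq_one_of_coprime hcop.symm (by omega)
      refine ⟨k * i, ?_⟩
      have : 3 * k ≡ 1 [MOD w.length] := by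
        rw [Nat.ModEq, hk.2, Nat.mod_eq_of_lt (by omega)]
      simpa [mul_assoc] using this.mul_right i
    exact ⟨j, (hinj _ _).2 hj⟩

end IsTrack
-- Induction along the descent
/-- The paths that the squares of the `3 × 3` board other than the center form. -/
def baseTrack (i : Dir) : List Square := [dirVec i]

theorem isTrack_baseTrack : IsTrack 1 2 1 1 baseTrack where
  pos_x := one_pos
  pos_y := one_pos
  length_even _ _ := rfl
  length_odd _ _ := rfl
  mem i s hs := by
    rw [baseTrack, List.mem_singleton] at hs
    subst hs
    fin_cases i <;> simp [frameSection, strip_zero, strip_one, strip_neg_one, dirVec]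
  nodup i := List.nodup_singleton _
  shift i := by
    fin_cases i <;> rfl
  tight i := by
    have h : ∀ i : Dir, dirVec i - dirVec i = 0 := fun i => sub_self _
    intro u hu v hv huv
    simp only [baseTrack, List.singleton_append, List.mem_cons, List.not_mem_nil, or_false]
      at hu hv ⊢
    rcases hu with rfl | rfl <;> rcases hv with rfl | rfl
    · simp [Step, IsMove] at huv
    · exact .inl ⟨0, rfl, rfl⟩
    · exact .inr ⟨0, rfl, rfl⟩
    · simp [Step, IsMove] at huv

theorem trackSet_baseTrack : trackSet baseTrack = frame 1 2 := by
  ext ⟨x, y⟩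
  simp only [trackSet, baseTrack, List.mem_singleton, frame, Set.mem_sdiff, mem_board,
    Set.mem_ofPred_eq, abs_lt]
  constructor
  · rintro ⟨i, hi⟩
    rw [Prod.ext_iff] at hi
    fin_cases i <;> simp [dirVec] at hi <;> simp [hi]
  · rintro ⟨⟨⟨h1, h2⟩, h3, h4⟩, h5⟩
    have hx : x = -1 ∨ x = 0 ∨ x = 1 := by omega
    have hy : y = -1 ∨ y = 0 ∨ y = 1 := by omega
    rcases hx with rfl | rfl | rfl <;> rcases hy with rfl | rfl | rfl
    · exact ⟨5, rfl⟩
    · exact ⟨4, rfl⟩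
    · exact ⟨3, rfl⟩
    · exact ⟨6, rfl⟩
    · simp at h5
    · exact ⟨2, rfl⟩
    · exact ⟨7, rfl⟩
    · exact ⟨0, rfl⟩
    · exact ⟨1, rfl⟩

theorem moveConnected_baseTrack : MoveConnected 1 2 (trackSet baseTrack) := by
  intro P hP
  have h (i j : Dir) (hij : IsMove 1 2 (dirVec j - dirVec i)) : P (dirVec i) ↔ P (dirVec j) :=
    ⟨hP _ ⟨i, by simp [baseTrack]⟩ _ ⟨j, by simp [baseTrack]⟩ hij,
      hP _ ⟨j, by simp [baseTrack]⟩ _ ⟨i, by simp [baseTrack]⟩ (by simpa using hij.neg)⟩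
  -- A knight goes around the ring in steps of three, and `3` generates the integers modulo `8`.
  have h3 (i : Dir) : P (dirVec i) ↔ P (dirVec (i + 3)) := by
    refine h _ _ ?_
    fin_cases i <;> simp [IsMove, dirVec]
  have h0 (i : Dir) : P (dirVec i) ↔ P (dirVec 0) := by
    have a1 := h3 0
    have a2 := h3 3
    have a3 := h3 6
    have a4 := h3 1
    have a5 := h3 4
    have a6 := h3 7
    have a7 := h3 2
    simp only [Fin.reduceAdd, zero_add] at a1 a2 a3 a4 a5 a6 a7
    fin_cases i <;> simp only [Fin.reduceFinMk, Fin.zero_eta, Fin.mk_one] <;> tauto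
  rintro u ⟨i, hu⟩ v ⟨j, hv⟩
  rw [baseTrack, List.mem_singleton] at hu hv
  subst hu hv
  rw [h0 i, h0 j]
  exact id

/-- The track of the oldest cycle of the leaper of the given descent. -/
def trackOfWord : List Lifting → Dir → List Square
  | [] => baseTrack
  | t :: e => t.path (frameOfWord e).1 (frameOfWord e).2 (trackOfWord e)

/-- The lengths of the paths of `trackOfWord`. -/
def lengthsOfWord : List Lifting → ℕ × ℕ
  | [] => (1, 1)
  | t :: e => t.lengths (lengthsOfWord e)

theorem coprime_of_dvd_imp {a b a' b' : ℕ} (h : Nat.Coprime a b)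
    (h' : ∀ d, d ∣ a' → d ∣ b' → d ∣ a ∧ d ∣ b) : Nat.Coprime a' b' :=
  Nat.dvd_one.1 (h ▸ Nat.dvd_gcd (h' _ (Nat.gcd_dvd_left _ _) (Nat.gcd_dvd_right _ _)).1
    (h' _ (Nat.gcd_dvd_left _ _) (Nat.gcd_dvd_right _ _)).2)

theorem frameOfWord_spec (e : List Lifting) : 0 < (frameOfWord e).1 ∧
    (frameOfWord e).1 < (frameOfWord e).2 ∧ Odd ((frameOfWord e).1 + (frameOfWord e).2) ∧
    Nat.Coprime (frameOfWord e).1 (frameOfWord e).2 := by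
  induction e with
  | nil => exact ⟨by decide, by decide, by decide, by decide⟩
  | cons t e ih =>
    rw [frameOfWord]
    generalize frameOfWord e = r at ih
    obtain ⟨m, n⟩ := r
    obtain ⟨hm, hmn, ⟨k, hk⟩, hc⟩ := ih
    cases t <;> simp only [Lifting.target] at *
    · refine ⟨hm, by omega, ⟨m + k, by omega⟩, coprime_of_dvd_imp hc fun d h1 h2 => ⟨h1, ?_⟩⟩
      exact (Nat.dvd_add_right (h1.mul_left 2)).1 h2
    · refine ⟨by omega, by omega, ⟨n + k - m, by omega⟩,
        coprime_of_dvd_imp hc fun d h1 h2 => ⟨?_, h1⟩⟩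
      have := Nat.dvd_sub (h1.mul_left 2) h2
      rwa [Nat.sub_sub_self (by omega)] at this
    · refine ⟨by omega, by omega, ⟨n + k, by omega⟩,
        coprime_of_dvd_imp hc fun d h1 h2 => ⟨?_, h1⟩⟩
      exact (Nat.dvd_add_left (h1.mul_left 2)).1 h2

theorem coprime_lengthsOfWord (e : List Lifting) :
    Nat.Coprime (lengthsOfWord e).1 (lengthsOfWord e).2 := by
  induction e with
  | nil => decide
  | cons t e ih =>
    rw [lengthsOfWord]
    generalize lengthsOfWord e = r at ih
    obtain ⟨x, y⟩ := r
    cases t <;> simp only [Lifting.lengths] at * <;> refine coprime_of_dvd_imp ih fun d h1 h2 => ?_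
    · exact ⟨(Nat.dvd_add_left (h2.mul_left 2)).1 h1, h2⟩
    · exact ⟨h1, (Nat.dvd_add_right (h1.mul_left 2)).1 h2⟩
    · have h3 : d ∣ x := by
        have := Nat.dvd_sub (h2.mul_left 2) h1
        rwa [show 2 * (2 * x + y) - (3 * x + 2 * y) = x by omega] at this
      exact ⟨h3, (Nat.dvd_add_right (h3.mul_left 2)).1 h2⟩

theorem isTrack_trackOfWord (e : List Lifting) :
    IsTrack (frameOfWord e).1 (frameOfWord e).2 (lengthsOfWord e).1 (lengthsOfWord e).2
      (trackOfWord e) := by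
  induction e with
  | nil => exact isTrack_baseTrack
  | cons t e ih =>
    obtain ⟨hm, hmn, hodd, -⟩ := frameOfWord_spec e
    exact ih.lift hm hmn hodd t

theorem moveConnected_trackOfWord (e : List Lifting) :
    MoveConnected (frameOfWord e).1 (frameOfWord e).2 (trackSet (trackOfWord e)) := by
  induction e with
  | nil => exact moveConnected_baseTrack
  | cons t e ih =>
    obtain ⟨hm, hmn, -, -⟩ := frameOfWord_spec e
    exact (isTrack_trackOfWord e).moveConnected_lift hm hmn t ih

theorem isCycleSet_trackOfWord (e : List Lifting) :
    IsCycleSet (frameOfWord e).1 (frameOfWord e).2 (trackSet (trackOfWord e)) := by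
  obtain ⟨hm, hmn, -, -⟩ := frameOfWord_spec e
  have T := isTrack_trackOfWord e
  refine ⟨?_, T.isToured hm hmn (moveConnected_trackOfWord e)⟩
  rintro s ⟨i, hi⟩
  exact frameSection_subset_board hmn i (T.mem i s hi)

theorem spaced_step_trackOfWord (e : List Lifting) (i : Dir) :
    Spaced 1 Step (arc (trackOfWord e) i 3) := by
  induction e generalizing i with
  | nil =>
    intro k u v hu hv
    have hk : k < 2 := by
      have := (List.getElem?_eq_some_iff.1 hv).1
      simp [arc, trackOfWord, baseTrack] at this
      omega
    interval_cases k <;> simp [arc, trackOfWord, baseTrack] at hu hv <;> subst hu hv <;>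
      fin_cases i <;> simp [Step, IsMove, dirVec]
  | cons t e ih =>
    have T := isTrack_trackOfWord e
    exact T.spaced_lift (fun _ _ => Step.symm) (fun w _ _ => (step_add_right w).2)
      (Nat.le_add_right_of_le T.pos_x) ih t i

instance (p q : ℕ) (v : Square) : Decidable (IsMove p q v) := by
  unfold IsMove; infer_instance

theorem spaced_of_getD {d : ℕ} {R : Square → Square → Prop} {l : List Square}
    (h : ∀ k < l.length - d, R (l.getD k 0) (l.getD (k + d) 0)) : Spaced d R l := by
  intro k u v hu hv
  have := h k (by have := (List.getElem?_eq_some_iff.1 hv).1; omega)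
  rwa [List.getD, List.getD, hu, hv] at this

/-- The induction for knight moves starts after the first lifting: `IsTrack.spaced_lift` needs `x +
y ≥ 3`, while the ring of eight squares has `x + y = 2`. -/
theorem spaced_knight_g (i : Dir) :
    Spaced 3 (fun u v => IsMove 1 2 (v - u)) (arc (trackOfWord [.g]) i 3) := by
  refine spaced_of_getD ?_
  revert i
  decide

theorem spaced_knight_h (i : Dir) :
    Spaced 3 (fun u v => IsMove 1 2 (v - u)) (arc (trackOfWord [.h]) i 3) := by
  refine spaced_of_getD ?_
  revert i
  decide

theorem two_lt_lengthsOfWord {t : Lifting} {e : List Lifting} :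
    3 ≤ (lengthsOfWord (t :: e)).1 + (lengthsOfWord (t :: e)).2 := by
  have T := isTrack_trackOfWord e
  have h1 := T.pos_x
  have h2 := T.pos_y
  rw [lengthsOfWord]
  generalize lengthsOfWord e = r at h1 h2
  obtain ⟨x, y⟩ := r
  cases t <;> simp only [Lifting.lengths] at * <;> omega

theorem spaced_knight_trackOfWord (e : List Lifting)
    (he : e = [] ∨ e.getLast? = some .g ∨ e.getLast? = some .h) :
    Spaced 3 (fun u v => IsMove 1 2 (v - u)) (arc (trackOfWord e) 0 16) := by
  rcases e.eq_nil_or_concat' with rfl | ⟨e, t, rfl⟩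
  -- The ring is checked on two full rounds, since its arcs of three paths have only three squares
  -- and say nothing about distance three.
  · refine spaced_of_getD ?_
    decide
  have ht : t = .g ∨ t = .h := by simpa using he
  clear he
  have key : ∀ i, Spaced 3 (fun u v => IsMove 1 2 (v - u)) (arc (trackOfWord (e ++ [t])) i 3) := by
    induction e with
    | nil => rcases ht with rfl | rfl; exacts [spaced_knight_g, spaced_knight_h]
    | cons s e ih =>
      have hlen : 3 ≤ (lengthsOfWord (e ++ [t])).1 + (lengthsOfWord (e ++ [t])).2 := by
        cases e <;> exact two_lt_lengthsOfWord
      exact (isTrack_trackOfWord (e ++ [t])).spaced_lift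
        (fun u v h => by simpa using h.neg) (fun w u v h => by simpa using h) hlen ih s
  have hlen : 3 ≤ (lengthsOfWord (e ++ [t])).1 + (lengthsOfWord (e ++ [t])).2 := by
    cases e <;> exact two_lt_lengthsOfWord
  exact (isTrack_trackOfWord _).spaced_arc hlen key 16 0

/-! ### Uniqueness of the descent and of the cycle of greatest type -/

/-- The type of a lifting is read off the ratio of the sides of the new frame: above `3` for `f`,
between `1` and `2` for `g`, between `2` and `3` for `h`. The ratio `2` is left to the `(1,
2)`-frame. -/
theorem Lifting.target_injective {t t' : Lifting} {m n m' n' : ℕ} (hm : 0 < m) (hmn : m < n)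
    (hm' : 0 < m') (hmn' : m' < n') (h : t.target (m, n) = t'.target (m', n')) :
    t = t' ∧ m = m' ∧ n = n' := by
  cases t <;> cases t' <;> simp only [Lifting.target, Prod.mk.injEq, reduceCtorEq, false_and,
    true_and] at h ⊢ <;> omega

theorem Lifting.target_ne {t : Lifting} {m n : ℕ} (hm : 0 < m) (hmn : m < n) :
    t.target (m, n) ≠ (1, 2) := by
  cases t <;> simp only [Lifting.target, ne_eq, Prod.mk.injEq] <;> omega

theorem frameOfWord_injective : Function.Injective frameOfWord := by
  intro e
  induction e with
  | nil =>
    intro e' h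
    cases e' with
    | nil => rfl
    | cons t e' =>
      obtain ⟨hm, hmn, -, -⟩ := frameOfWord_spec e'
      exact absurd h.symm (Lifting.target_ne hm hmn)
  | cons t e ih =>
    intro e' h
    obtain ⟨hm, hmn, -, -⟩ := frameOfWord_spec e
    cases e' with
    | nil => exact absurd h (Lifting.target_ne hm hmn)
    | cons t' e' =>
      obtain ⟨hm', hmn', -, -⟩ := frameOfWord_spec e'
      obtain ⟨rfl, h1, h2⟩ := Lifting.target_injective hm hmn hm' hmn' h
      rw [ih (Prod.ext h1 h2)]

/-- The number of letters `g` and `h` of a word. -/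
def depth : List Lifting → ℕ
  | [] => 0
  | .f :: e => depth e
  | .g :: e => depth e + 1
  | .h :: e => depth e + 1

theorem lift_trackSet_trackOfWord (t : Lifting) (e : List Lifting) :
    t.lift (frameOfWord e).1 (frameOfWord e).2 (trackSet (trackOfWord e)) =
      trackSet (trackOfWord (t :: e)) := by
  obtain ⟨hm, hmn, -, -⟩ := frameOfWord_spec e
  exact (isTrack_trackOfWord e).lift_trackSet hm hmn t

theorem cycleOfWord_trackOfWord (e : List Lifting) :
    CycleOfWord e (depth e + 1) (trackSet (trackOfWord e)) := by
  induction e with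
  | nil => exact trackSet_baseTrack ▸ .base
  | cons t e ih =>
    rw [← lift_trackSet_trackOfWord]
    cases t
    exacts [.lift_f ih, .lift_g ih, .lift_h ih]

/-- A shell cycle enters with type `1` when the depth is already positive, and from then on type and
depth grow together. So it stays below the maximum, which only the base cycle attains. -/
theorem CycleOfWord.le_depth {e : List Lifting} {i : ℕ} {S : Set Square} (h : CycleOfWord e i S) :
    i ≤ depth e + 1 ∧ (i = depth e + 1 → S = trackSet (trackOfWord e)) := by
  induction h with
  | base => exact ⟨le_rfl, fun _ => trackSet_baseTrack.symm⟩
  | lift_f _ ih =>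
    refine ⟨ih.1, fun h => ?_⟩
    rw [← lift_trackSet_trackOfWord, ih.2 h]
  | lift_g _ ih | lift_h _ ih =>
    refine ⟨Nat.succ_le_succ ih.1, fun h => ?_⟩
    rw [← lift_trackSet_trackOfWord, ih.2 (Nat.succ_injective h)]
  | shell_g | shell_h => exact ⟨by simp, fun h => by simp [depth] at h⟩

/-! ### Continued fractions of the frame and of the path lengths -/

/-- The descent of a leaper in terms of its even continued fraction. -/
def wordOfCF : List (ℕ × ℤˣ) → ℕ → List Lifting
  | [], last => .replicate ((last - 2) / 2) .f
  | (c, s) :: init, last =>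
    .replicate ((c - 2) / 2) .f ++ (if s = 1 then .h else .g) :: wordOfCF init last

section replicate
variable (k : ℕ) (e : List Lifting)

theorem frameOfWord_replicate_append : frameOfWord (.replicate k .f ++ e) =
    ((frameOfWord e).1, (frameOfWord e).2 + 2 * k * (frameOfWord e).1) := by
  induction k with
  | zero => simp
  | succ k ih =>
    rw [List.replicate_succ, List.cons_append, frameOfWord, ih]
    simp only [Lifting.target, Prod.mk.injEq, true_and]
    ring

theorem lengthsOfWord_replicate_append : lengthsOfWord (.replicate k .f ++ e) =
    ((lengthsOfWord e).1 + 2 * k * (lengthsOfWord e).2, (lengthsOfWord e).2) := by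
  induction k with
  | zero => simp
  | succ k ih =>
    rw [List.replicate_succ, List.cons_append, lengthsOfWord, ih]
    simp only [Lifting.lengths, Prod.mk.injEq, and_true]
    ring

theorem depth_replicate_append : depth (.replicate k .f ++ e) = depth e := by
  induction k with
  | zero => rfl
  | succ k ih => exact ih

end replicate

theorem depth_wordOfCF (init : List (ℕ × ℤˣ)) (last : ℕ) :
    depth (wordOfCF init last) = init.length := by
  induction init with
  | nil => simpa [wordOfCF, depth] using depth_replicate_append ((last - 2) / 2) []
  | cons t init ih =>
    rw [wordOfCF, depth_replicate_append, List.length_cons, ← ih]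
    split_ifs <;> rfl

/-- The innermost term contributes `last / 2 - 1` letters `f` at the end of the word, none exactly
when `last = 2`. -/
theorem getLast?_wordOfCF {init : List (ℕ × ℤˣ)} {last : ℕ} (heven : Even last)
    (hpos : 0 < last) : last = 2 ↔ wordOfCF init last = [] ∨
      (wordOfCF init last).getLast? = some .g ∨ (wordOfCF init last).getLast? = some .h := by
  obtain ⟨r, rfl⟩ := heven
  obtain ⟨r, rfl⟩ : ∃ r', r = r' + 1 := ⟨r - 1, by omega⟩
  have e : (r + 1 + (r + 1) - 2) / 2 = r := by omega
  induction init with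
  | nil =>
    rw [wordOfCF, e]
    cases r with
    | zero => simp
    | succ r =>
      simp [List.getLast?_replicate]
      omega
  | cons t init ih =>
    refine ih.trans ?_
    rw [wordOfCF]
    cases hw : wordOfCF init (r + 1 + (r + 1)) with
    | nil => simpa using em' _
    | cons s w => simp [List.getLast?_append, List.getLast?_cons_cons]

/-- The first `2` comes from the letter `g` or `h` after the block, or from the `(1, 2)`-frame; each
`f` of the block adds another `2`. -/
theorem cast_sub_two_div_two {c : ℕ} (heven : Even c) (hpos : 0 < c) :
    (c : ℚ) = 2 + 2 * ((c - 2) / 2 : ℕ) := by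
  obtain ⟨r, rfl⟩ := heven
  have : r + r = 2 + 2 * ((r + r - 2) / 2) := by omega
  exact_mod_cast this

/-- On `r = n / m`, `f` acts as `r + 2`, `h` as `2 + 1 / r` and `g` as `2 - 1 / r`. -/
theorem cfValue_wordOfCF {init : List (ℕ × ℤˣ)} {last : ℕ}
    (h : ∀ c ∈ init.map Prod.fst ++ [last], Even c ∧ 0 < c) :
    cfValue init last =
      (frameOfWord (wordOfCF init last)).2 / (frameOfWord (wordOfCF init last)).1 := by
  induction init with
  | nil =>
    have := h last (by simp)
    have e := frameOfWord_replicate_append ((last - 2) / 2) []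
    rw [List.append_nil] at e
    rw [wordOfCF, e]
    simp [cfValue, frameOfWord, cast_sub_two_div_two this.1 this.2]
  | cons t init ih =>
    obtain ⟨c, s⟩ := t
    have hc := h c (by simp)
    have ih := ih fun c hc => h c (by simp at hc ⊢; tauto)
    obtain ⟨hm, hmn, -, -⟩ := frameOfWord_spec (wordOfCF init last)
    rw [wordOfCF, frameOfWord_replicate_append, frameOfWord]
    have e : cfValue ((c, s) :: init) last = c + ((s : ℤ) : ℚ) / cfValue init last := rfl
    rw [e, ih, cast_sub_two_div_two hc.1 hc.2]
    generalize frameOfWord (wordOfCF init last) = r at *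
    obtain ⟨m, n⟩ := r
    simp only at hm hmn
    have hn : (n : ℚ) ≠ 0 := by
      have : 0 < n := by omega
      positivity
    have hm' : (m : ℚ) ≠ 0 := by positivity
    rcases Int.units_eq_one_or s with rfl | rfl
    · simp [Lifting.target]
      field_simp
      ring
    · have : ((2 * n - m : ℕ) : ℚ) = 2 * n - m := by
        rw [Nat.cast_sub (by omega)]; push_cast; rfl
      simp [Lifting.target, this]
      field_simp
      ring

/-- On `r = (x + y) / y`, `f` acts as `r + 2`, while `h` and `g` act as `2 + 1 / (2 - 1 / r)` and `2
- 1 / (2 - 1 / r)`. -/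
theorem interleavedValue_wordOfCF {init : List (ℕ × ℤˣ)} {last : ℕ}
    (h : ∀ c ∈ init.map Prod.fst ++ [last], Even c ∧ 0 < c) :
    interleavedValue init last =
      ((lengthsOfWord (wordOfCF init last)).1 + (lengthsOfWord (wordOfCF init last)).2 : ℕ) /
        ((lengthsOfWord (wordOfCF init last)).2 : ℕ) := by
  induction init with
  | nil =>
    have := h last (by simp)
    have e := lengthsOfWord_replicate_append ((last - 2) / 2) []
    rw [List.append_nil] at e
    rw [wordOfCF, e]
    simp [interleavedValue, cfValue, lengthsOfWord, cast_sub_two_div_two this.1 this.2]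
    ring
  | cons t init ih =>
    obtain ⟨c, s⟩ := t
    have hc := h c (by simp)
    have ih := ih fun c hc => h c (by simp at hc ⊢; tauto)
    have T := isTrack_trackOfWord (wordOfCF init last)
    have hx := T.pos_x
    have hy := T.pos_y
    rw [wordOfCF, lengthsOfWord_replicate_append, lengthsOfWord]
    have e : interleavedValue ((c, s) :: init) last =
        c + ((s : ℤ) : ℚ) / (2 + (-1) / interleavedValue init last) := by
      simp [interleavedValue, cfValue]
    rw [e, ih, cast_sub_two_div_two hc.1 hc.2]
    generalize lengthsOfWord (wordOfCF init last) = r at *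
    obtain ⟨x, y⟩ := r
    simp only at hx hy
    have hy' : (y : ℚ) ≠ 0 := by positivity
    have hxy : (x + y : ℚ) ≠ 0 := by positivity
    have h2 : (2 * x + y : ℚ) ≠ 0 := by positivity
    have e2 : (2 + -1 / (((x + y : ℕ) : ℚ) / (y : ℕ))) = (2 * x + y) / (x + y) := by
      push_cast
      field_simp
      ring
    rw [e2]
    rcases Int.units_eq_one_or s with rfl | rfl
    · simp [Lifting.lengths]
      field_simp
      ring
    · simp [Lifting.lengths]
      field_simp
      ring

/-- Only the first term could vanish. What follows it is itself the ratio of a frame and exceeds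
`1`, so a first term `0` would give a value below `1`, against `q / p > 1`. -/
theorem isEvenCF_pos {p q : ℕ} (hp : 0 < p) (hpq : p < q) {init : List (ℕ × ℤˣ)} {last : ℕ}
    (hcf : IsEvenCF init last) (hval : cfValue init last = (q : ℚ) / p) :
    ∀ c ∈ init.map Prod.fst ++ [last], Even c ∧ 0 < c := by
  have h1 : 1 < cfValue init last := by
    rw [hval, one_lt_div (by positivity)]
    exact_mod_cast hpq
  intro c hc
  refine ⟨hcf.1 c hc, ?_⟩
  cases init with
  | nil =>
    obtain rfl : c = last := by simpa using hc
    by_contra h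
    obtain rfl : c = 0 := by omega
    norm_num [cfValue] at h1
  | cons t init =>
    obtain ⟨c', s⟩ := t
    rcases List.mem_cons.1 hc with h0 | hc
    · have h := cfValue_wordOfCF (init := init) (last := last) fun c hc =>
        ⟨hcf.1 c (.tail _ hc), hcf.2 c hc⟩
      have e : cfValue ((c', s) :: init) last = c' + ((s : ℤ) : ℚ) / cfValue init last := rfl
      obtain ⟨hm, hmn, -, -⟩ := frameOfWord_spec (wordOfCF init last)
      have hlt : 1 < cfValue init last := by
        rw [h, one_lt_div (by exact_mod_cast hm)]
        exact_mod_cast hmn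
      rw [e] at h1
      by_contra hc0
      obtain rfl : c' = 0 := by simp at h0; omega
      have h2 : 1 / cfValue init last < 1 := by rwa [div_lt_one (by linarith)]
      have h3 : 0 < 1 / cfValue init last := by positivity
      rcases Int.units_eq_one_or s with rfl | rfl
      · simp at h1 h2
        linarith
      · simp [neg_div] at h1
        rw [one_div] at h3
        linarith
    · exact hcf.2 c hc

theorem isDescent_wordOfCF {p q : ℕ} (hp : 0 < p) (hcop : Nat.Coprime p q)
    {init : List (ℕ × ℤˣ)} {last : ℕ} (h : ∀ c ∈ init.map Prod.fst ++ [last], Even c ∧ 0 < c)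
    (hval : cfValue init last = (q : ℚ) / p) : IsDescent p q (wordOfCF init last) := by
  rw [cfValue_wordOfCF h] at hval
  obtain ⟨hm, -, -, hc⟩ := frameOfWord_spec (wordOfCF init last)
  have h1 := Rat.div_int_inj (a := (frameOfWord (wordOfCF init last)).2)
    (b := (frameOfWord (wordOfCF init last)).1) (c := q) (d := p) (by exact_mod_cast hm)
    (by exact_mod_cast hp) (by simpa using hc.symm) (by simpa using hcop.symm)
    (by simpa using hval)
  exact Prod.ext (by exact_mod_cast h1.2) (by exact_mod_cast h1.1)

end Leaper

/-! ### The third leaper theorem -/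

theorem mainTheorem4 (p q : ℕ) (hp : 0 < p) (hpq : p < q) (hodd : Odd (p + q))
    (hcop : Nat.Coprime p q)
    -- the representation of `q / p` as an even continued fraction, with `k = init.length + 1` terms
    (init : List (ℕ × ℤˣ)) (last : ℕ) (hcf : Leaper.IsEvenCF init last)
    (hval : Leaper.cfValue init last = (q : ℚ) / (p : ℚ)) :
    (∀ e : List Leaper.Lifting, Leaper.IsDescent p q e →
      (last = 2 ↔ e = [] ∨ e.getLast? = some .g ∨ e.getLast? = some .h)) ∧
    (last = 2 → ¬ (3 : ℤ) ∣ (Leaper.interleavedValue init last).num →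
      ∃ C : Set Leaper.Square,
        -- `C` is the unique cycle of type `k`
        (∀ S : Set Leaper.Square, Leaper.IsCycleOfType p q (init.length + 1) S ↔ S = C) ∧
        Leaper.IsCycleSet p q C ∧
        -- a proper Hamiltonian cycle of the `(0, 1)`-leaper over `C` exists
        (∃ (a : C) (w : (Leaper.leaperGraphOn 0 1 C).Walk a a), Leaper.IsProperTour p q w) ∧
        -- taking every third square of it yields a Hamiltonian cycle of the `(1, 2)`-leaper
        (∀ (a : C) (w : (Leaper.leaperGraphOn 0 1 C).Walk a a), Leaper.IsProperTour p q w →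
          ∃ w' : (Leaper.leaperGraphOn 1 2 C).Walk a a, w'.IsHamiltonianCycle ∧
            w'.length = w.length ∧
            ∀ i ≤ w.length, w'.getVert i = w.getVert (3 * i % w.length))) := by
  have hpos := Leaper.isEvenCF_pos hp hpq hcf hval
  have hdesc := Leaper.isDescent_wordOfCF hp hcop hpos hval
  have hdepth := Leaper.depth_wordOfCF init last
  have huniq (e : List Leaper.Lifting) (he : Leaper.IsDescent p q e) :
      e = Leaper.wordOfCF init last := Leaper.frameOfWord_injective (he.trans hdesc.symm)
  have hlast := hpos last (by simp)
  have hiff := Leaper.getLast?_wordOfCF (init := init) hlast.1 hlast.2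
  refine ⟨fun e he => by rw [huniq e he]; exact hiff, fun h2 h3 => ?_⟩
  have hnum := Leaper.interleavedValue_wordOfCF hpos
  generalize Leaper.wordOfCF init last = e at *
  have T := Leaper.isTrack_trackOfWord e
  have hset := Leaper.isCycleSet_trackOfWord e
  have hpq' : Leaper.frameOfWord e = (p, q) := hdesc
  simp only [hpq'] at T hset
  refine ⟨Leaper.trackSet (Leaper.trackOfWord e), fun S => ⟨?_, ?_⟩, hset, ?_, fun a w hw => ?_⟩
  · rintro ⟨e', he', hS⟩
    rw [huniq e' he'] at hS
    exact hS.le_depth.2 (by rw [hdepth])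
  · rintro rfl
    exact ⟨e, hdesc, hdepth ▸ Leaper.cycleOfWord_trackOfWord e⟩
  · exact T.exists_isProperTour hpq (Nat.le_add_right_of_le T.pos_x)
      (Leaper.spaced_step_trackOfWord e)
  · refine T.exists_knight_tour hpq hodd (Nat.add_le_add T.pos_x T.pos_y)
      (Leaper.spaced_knight_trackOfWord e (hiff.1 h2)) (fun h => h3 ?_) hw.1
    rw [hnum]
    -- Coprimality of the path lengths puts `(x + y) / y` in lowest terms, so the numerator is `x +
    -- y`, a quarter of the number of squares.
    have := Rat.num_div_eq_of_coprime
      (a := ((Leaper.lengthsOfWord e).1 + (Leaper.lengthsOfWord e).2 : ℕ))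
      (b := ((Leaper.lengthsOfWord e).2 : ℕ)) (by exact_mod_cast T.pos_y)
      (by
        rw [Int.natAbs_natCast, Int.natAbs_natCast]
        simpa using Leaper.coprime_lengthsOfWord e)
    rw [Int.cast_natCast, Int.cast_natCast] at this
    rw [this]
    exact_mod_cast h
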